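/- **Conventions.** An $\ell$-graph is a finite $\ell$-uniform hypergraph $G=(V(G),E(G))$ with $v(G)$ vertices and $e(G)$ edges; subgraphs need not be induced. Put $m(G)=\max_{J\subseteq G,\,v(J)\ge 1} e(J)/v(J)$ (and $m(G)=0$ if $G$ has no vertices). If $v(G)\ge \ell+1$, put $d_\ell(G)=\frac{e(G)-1}{v(G)-\ell}$ and $m_\ell(G)=\max_{J\subseteq G,\,v(J)\ge \ell+1} d_\ell(J)$; $G$ is *strictly $\ell$-balanced* if $m_\ell(G)=d_\ell(G)>d_\ell(J)$ for every proper subgraph $J\subsetneq G$ with $v(J)\ge \ell+1$. For an $\ell$-graph $F$ with at least two edges, $\gamma(F)$ is the largest size of the intersection of two distinct edges of $F$. An $F$-copy in $G$ is a subgraph of $G$ isomorphic to $F$. An edge $e$ of an $\ell$-graph $G$ is *$F$-closed* if it lies in at least two $F$-copies in $G$ and, in case $\gamma(F)<\ell-1$, moreover for every other edge $e'$ of $G$ some $F$-copy in $G$ contains exactly one of $e,e'$. An $F$-copy in $G$ is *$F$-closed* if at least three of its edges are $F$-closed. The $\ell$-graph $G$ is *$F$-closed* if every vertex and every edge of $G$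 belongs to an $F$-copy in $G$ and every $F$-copy in $G$ is $F$-closed. An *$F$-block* is an $F$-closed $\ell$-graph $B$ such that for every non-empty proper subset $E'\subsetneq E(B)$ there is an $F$-copy in $B$ having an edge in $E'$ and an edge not in $E'$. $G^{(\ell)}(n,p)$ is the random $\ell$-graph on $n$ vertices in which every $\ell$-set of vertices is an edge independently with probability $p=p(n)\in[0,1]$; "w.h.p." means with probability tending to $1$ as $n\to\infty$. **Corollary 2.6.** Let $\ell\ge 2$ be an integer and let $F$ be a strictly $\ell$-balanced $\ell$-graph such that either $\gamma(F)=\ell-1$ and $F$ has at least $3$ edges, or $F$ has at least $4$ edges. Then there exists a constant $c>0$ (depending only on $F$ and $\ell$) such that, if $p=p(n)\le c\,n^{-1/m_\ell(F)}$ for all sufficiently large $n$, then w.h.p. every $F$-block $B\subseteq G^{(\ell)}(n,p)$ satisfies $m(B)\le m_\ell(F)$. Moreover, if $p=o\bigl(n^{-1/m_\ell(F)}\bigr)$, then w.h.p. every $F$-block $B\subseteq G^{(\ell)}(n,p)$ satisfies $m(B)< m_\ell(F)$. -/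

import Mathlib

namespace Hypergraph

variable {V W : Type*}

/-- An `ℓ`-graph: a finite hypergraph all of whose edges have exactly `ℓ` vertices. -/
structure IsUniformGraph (ℓ : ℕ) (G : Hypergraph V) : Prop where
  finite_vertexSet : G.vertexSet.Finite
  ncard_edge : ∀ e ∈ G.edgeSet, e.ncard = ℓ

/-- `J ⊆ G`: not necessarily induced, not necessarily spanning subgraph. -/
def IsSubgraph (J G : Hypergraph V) : Prop :=
  J.vertexSet ⊆ G.vertexSet ∧ J.edgeSet ⊆ G.edgeSet

/-- The number of vertices `v(G)`. -/
noncomputable def numVerts (G : Hypergraph V) : ℕ := G.vertexSet.ncard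

/-- The number of edges `e(G)`. -/
noncomputable def numEdges (G : Hypergraph V) : ℕ := G.edgeSet.ncard

/-- The density `d(G) = e(G) / v(G)`. -/
noncomputable def density (G : Hypergraph V) : ℝ := (G.numEdges : ℝ) / (G.numVerts : ℝ)

/-- `m(G)`, the maximum of `d(J)` over all subgraphs `J ⊆ G` with at least one vertex
(and `0` when `G` has no vertices). -/
noncomputable def maxDensity (G : Hypergraph V) : ℝ :=
  sSup {x : ℝ | ∃ J : Hypergraph V, J.IsSubgraph G ∧ 1 ≤ J.numVerts ∧ x = J.density}

/-- The `ℓ`-density `d_ℓ(G) = (e(G) - 1) / (v(G) - ℓ)`, used when `v(G) ≥ ℓ + 1`. -/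
noncomputable def lDensity (ℓ : ℕ) (G : Hypergraph V) : ℝ :=
  ((G.numEdges : ℝ) - 1) / ((G.numVerts : ℝ) - (ℓ : ℝ))

/-- `m_ℓ(G)`, the maximum of `d_ℓ(J)` over all subgraphs `J ⊆ G` with at least `ℓ + 1`
vertices. -/
noncomputable def maxLDensity (ℓ : ℕ) (G : Hypergraph V) : ℝ :=
  sSup {x : ℝ | ∃ J : Hypergraph V, J.IsSubgraph G ∧ ℓ + 1 ≤ J.numVerts ∧ x = J.lDensity ℓ}

/-- `G` is strictly `ℓ`-balanced. -/
def IsStrictlyBalanced (ℓ : ℕ) (G : Hypergraph V) : Prop :=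
  ℓ + 1 ≤ G.numVerts ∧ G.maxLDensity ℓ = G.lDensity ℓ ∧
    ∀ J : Hypergraph V, J.IsSubgraph G → J ≠ G → ℓ + 1 ≤ J.numVerts →
      J.lDensity ℓ < G.maxLDensity ℓ

/-- `γ(F)`, the largest size of the intersection of two distinct edges of `F`. -/
noncomputable def maxInter (F : Hypergraph W) : ℕ :=
  sSup {k : ℕ | ∃ e₁ ∈ F.edgeSet, ∃ e₂ ∈ F.edgeSet, e₁ ≠ e₂ ∧ k = (e₁ ∩ e₂).ncard}

/-- `F'` is an `F`-copy in `G`: a subgraph of `G` which is isomorphic to `F`. -/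
def IsCopyIn (F : Hypergraph W) (F' G : Hypergraph V) : Prop :=
  F'.IsSubgraph G ∧ ∃ f : W → V, Set.InjOn f F.vertexSet ∧ F.image f = F'

/-- Two edges are `F`-equivalent in `G` if every `F`-copy in `G` contains both or neither. -/
def EdgeEquiv (F : Hypergraph W) (G : Hypergraph V) (e₁ e₂ : Set V) : Prop :=
  ∀ F' : Hypergraph V, F.IsCopyIn F' G → (e₁ ∈ F'.edgeSet ↔ e₂ ∈ F'.edgeSet)

/-- The set `e` belongs to at least two `F`-copies in `G`. -/
def InTwoCopies (F : Hypergraph W) (G : Hypergraph V) (e : Set V) : Prop :=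
  ∃ F₁ F₂ : Hypergraph V, F₁ ≠ F₂ ∧ F.IsCopyIn F₁ G ∧ F.IsCopyIn F₂ G ∧
    e ∈ F₁.edgeSet ∧ e ∈ F₂.edgeSet

/-- The edge `e` of the `ℓ`-graph `G` is `F`-closed. -/
def IsClosedEdge (ℓ : ℕ) (F : Hypergraph W) (G : Hypergraph V) (e : Set V) : Prop :=
  e ∈ G.edgeSet ∧
    ((F.maxInter = ℓ - 1 ∧ F.InTwoCopies G e) ∨
      (F.maxInter < ℓ - 1 ∧ F.InTwoCopies G e ∧
        ∀ e' ∈ G.edgeSet, e' ≠ e → ¬ F.EdgeEquiv G e e'))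

/-- An `F`-copy `F'` in `G` is `F`-closed if at least three of its edges are `F`-closed
(as edges of `G`). -/
def IsClosedCopy (ℓ : ℕ) (F : Hypergraph W) (F' G : Hypergraph V) : Prop :=
  ∃ e₁ ∈ F'.edgeSet, ∃ e₂ ∈ F'.edgeSet, ∃ e₃ ∈ F'.edgeSet,
    e₁ ≠ e₂ ∧ e₁ ≠ e₃ ∧ e₂ ≠ e₃ ∧
      IsClosedEdge ℓ F G e₁ ∧ IsClosedEdge ℓ F G e₂ ∧ IsClosedEdge ℓ F G e₃

/-- The `ℓ`-graph `G` is `F`-closed. -/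
structure IsClosedGraph (ℓ : ℕ) (F : Hypergraph W) (G : Hypergraph V) : Prop where
  vertex_mem_copy : ∀ x ∈ G.vertexSet, ∃ F' : Hypergraph V, F.IsCopyIn F' G ∧ x ∈ F'.vertexSet
  edge_mem_copy : ∀ e ∈ G.edgeSet, ∃ F' : Hypergraph V, F.IsCopyIn F' G ∧ e ∈ F'.edgeSet
  closed_copy : ∀ F' : Hypergraph V, F.IsCopyIn F' G → IsClosedCopy ℓ F F' G

/-- The `ℓ`-graph `B` is an `F`-block: it is `F`-closed, and for every non-empty proper subset
`E'` of its edges some `F`-copy in `B` has edges both inside and outside `E'`. -/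
structure IsBlock (ℓ : ℕ) (F : Hypergraph W) (B : Hypergraph V) : Prop where
  isClosedGraph : IsClosedGraph ℓ F B
  exists_copy : ∀ E' : Set (Set V), E'.Nonempty → E' ⊂ B.edgeSet →
    ∃ F' : Hypergraph V, F.IsCopyIn F' B ∧
      (F'.edgeSet ∩ E').Nonempty ∧ (F'.edgeSet \ E').Nonempty

/-- The hypergraph with vertex set the whole type and edge set `S`. -/
def ofEdgeSet (S : Set (Set V)) : Hypergraph V where
  vertexSet := Set.univ
  edgeSet := S
  subset_vertexSet_of_mem_edgeSet' := fun _ _ => Set.subset_univ _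

/-- The probability that the binomial random `ℓ`-graph `G^{(ℓ)}(n, p)` on the vertex set `Fin n`
has property `P`: every `ℓ`-subset of the vertices is an edge with probability `p`, independently
of the others, and no other set is an edge. -/
noncomputable def randomProb (ℓ n : ℕ) (p : unitInterval) (P : Hypergraph (Fin n) → Prop) : ℝ :=
  (ProbabilityTheory.setBernoulli {e : Set (Fin n) | e.ncard = ℓ} p).real
    {S : Set (Set (Fin n)) | P (ofEdgeSet S)}

end Hypergraph

/-!
By a first moment argument it suffices to bound the number of vertices of an `F`-block: among
boundedly many vertices and edges, a subgraph `J` with `e(J) > m_ℓ(F) v(J)` has expected number of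
occurrences of order `n ^ v(J) p ^ e(J) → 0`, and `e(J) ≥ m_ℓ(F) v(J)` is enough if
`p = o(n ^ (-1 / m_ℓ(F)))`.

To bound the blocks, explore a block `B` one `F`-copy at a time. Each new copy shares an edge with
the graph `G` explored so far and is not contained in it. As `F` is strictly balanced, the expected
number of ways to attach it is at most `n ^ (-α)` up to logarithmic factors, for some fixed `α > 0`, unless
the copy meets `G` in a single edge and nothing else. In the latter, regular case, the expected
number of ways is a constant, small with `c`, as soon as the edge is chosen from a given copy. So
the copies are attached in breadth first order: a pointer moves through the explored copies, and new
copies are attached at the copy under the pointer until all copies of `B` sharing an edge with it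
are explored. The movements of the pointer are paid for by a geometric weight (`listWeight`). Hence
with high probability there is no exploration of logarithmic length, and none with more than some
constant number `D` of degenerate, i.e. non-regular, steps (`prob_large_block_le`).

It remains to see that an exploration of all of `B` with `d` degenerate steps has `O(d)` steps
(`exploration_length_le`). A copy attached regularly has at least two new edges which are closed in
`B`. The point is that, unless a degenerate step interferes, at least two of its new edges must then
serve as attachment edges of later regular steps (`two_le_card_attached`). A step has one attachment
edge, and different copies have different new edges, so twice the number of
regular steps without interference is at most the number of all regular steps. A degenerate step
interferes with a bounded number of copies only, since the sets of new vertices are disjoint.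

The lower bound of two edges rests on an exchange lemma (`IsBalancedFamily.exchange`): when a copy
`φ` has been attached at the edge `e`, another copy using one of the new edges uses all of them, and
only `e` is replaced by an edge with the same trace on the new edges. If `γ(F) = ℓ - 1` the copy is
therefore `φ` itself, so that the new edges are in no second copy; otherwise any two of the new
edges are equivalent. Attaching copies at a single new edge does not change this for the remaining
ones, because an edge of `F` meets the union of the others in more than `γ(F)` vertices
(`IsBalancedFamily.card_inter_lt`).
-/

namespace Hypergraph

open Finset

/-! ### Strictly balanced families and the exchange lemma -/

section

variable {X V : Type*}

lemma lt_card_of_ne {ℓ : ℕ} {S a b : Finset X} (ha : #a = ℓ) (hb : #b = ℓ) (hab : a ≠ b)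
    (haS : a ⊆ S) (hbS : b ⊆ S) : ℓ + 1 ≤ #S := by
  by_contra! h
  have h1 := eq_of_subset_of_card_le haS (by omega)
  have h2 := eq_of_subset_of_card_le hbS (by omega)
  exact hab (h1.trans h2.symm)

/-- A finite family `E` of `ℓ`-subsets of a finite type `X`, viewed as the edge set of an `ℓ`-graph
with vertex set `X`, which is strictly `ℓ`-balanced with `m_ℓ = m`. The densities are cleared of
denominators: `d_ℓ(S, Q) < m` for a subgraph with vertex set `S` and edge set `Q` reads
`m ℓ - 1 < m |S| - |Q|`. -/
structure IsBalancedFamily [Fintype X] (ℓ : ℕ) (m : ℝ) (E : Finset (Finset X)) : Prop where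
  card_edge : ∀ a ∈ E, #a = ℓ
  pos : 0 < m
  whole : m * Fintype.card X - #E = m * ℓ - 1
  strict : ∀ (S : Finset X) (Q : Finset (Finset X)), Q ⊆ E → (∀ a ∈ Q, a ⊆ S) → ℓ + 1 ≤ #S →
    (S ≠ univ ∨ Q ≠ E) → m * ℓ - 1 < m * #S - #Q

/-- The edge set of the copy of `E` given by the embedding `φ` of its vertices. -/
def copyEdges [DecidableEq V] (E : Finset (Finset X)) (φ : X ↪ V) : Finset (Finset V) :=
  E.image (Finset.map φ)

section

variable [DecidableEq V]

lemma mem_copyEdges {E : Finset (Finset X)} {φ : X ↪ V} {e : Finset V} :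
    e ∈ copyEdges E φ ↔ ∃ a ∈ E, a.map φ = e := by simp [copyEdges]

lemma card_copyEdges (E : Finset (Finset X)) (φ : X ↪ V) : #(copyEdges E φ) = #E :=
  card_image_of_injective _ (Finset.map_injective φ)

end

variable [Fintype X] [DecidableEq V]

lemma subset_of_mem_copyEdges {E : Finset (Finset X)} {φ : X ↪ V} {e : Finset V}
    (he : e ∈ copyEdges E φ) : e ⊆ univ.map φ := by
  obtain ⟨a, -, rfl⟩ := mem_copyEdges.1 he
  exact map_subset_map.2 (subset_univ a)

namespace IsBalancedFamily

variable {ℓ : ℕ} {m : ℝ} {E : Finset (Finset X)}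

lemma card_of_mem_copyEdges (hE : IsBalancedFamily ℓ m E) {φ : X ↪ V} {e : Finset V}
    (he : e ∈ copyEdges E φ) : #e = ℓ := by
  obtain ⟨a, ha, rfl⟩ := mem_copyEdges.1 he
  rw [card_map, hE.card_edge a ha]

variable [DecidableEq X]

/-- A subgraph with an edge is a single edge, or everything, or it satisfies the strict balance
inequality. -/
lemma trichotomy (hE : IsBalancedFamily ℓ m E) {S : Finset X} {Q : Finset (Finset X)}
    (hQ : Q ⊆ E) (hne : Q.Nonempty) (hS : ∀ a ∈ Q, a ⊆ S) :
    Q = {S} ∨ (S = univ ∧ Q = E) ∨ m * ℓ - 1 < m * #S - #Q := by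
  by_cases h : Q = {S}
  · exact Or.inl h
  right
  by_cases h2 : S = univ ∧ Q = E
  · exact Or.inl h2
  right
  refine hE.strict S Q hQ hS ?_ (by tauto)
  obtain ⟨a, ha⟩ := hne
  by_contra! hlt
  refine h (eq_singleton_iff_unique_mem.2 ?_)
  have key : ∀ b ∈ Q, b = S := fun b hb =>
    eq_of_subset_of_card_le (hS b hb) (by have := hE.card_edge b (hQ hb); omega)
  exact ⟨key a ha ▸ ha, key⟩

/-- The trichotomy for subgraphs of a copy. -/
lemma copy_trichotomy (hE : IsBalancedFamily ℓ m E) (φ : X ↪ V) {S : Finset V}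
    {Q : Finset (Finset V)} (hQ : Q ⊆ copyEdges E φ) (hne : Q.Nonempty) (hS : ∀ a ∈ Q, a ⊆ S)
    (hSφ : S ⊆ univ.map φ) :
    Q = {S} ∨ (S = univ.map φ ∧ Q = copyEdges E φ) ∨ m * ℓ - 1 < m * #S - #Q := by
  obtain ⟨S, -, rfl⟩ := subset_map_iff.1 hSφ
  obtain ⟨Q, hQE, rfl⟩ := subset_image_iff.1 hQ
  have hinj := Finset.map_injective φ
  rcases hE.trichotomy (S := S) (Q := Q) (by exact_mod_cast hQE) (by simpa using hne)
    (fun a ha => map_subset_map.1 (hS _ (mem_image_of_mem _ ha))) with h | h | h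
  · left; rw [h, image_singleton]
  · right; left; exact ⟨by rw [h.1], by rw [h.2, copyEdges]⟩
  · right; right
    rwa [card_map, card_image_of_injective _ hinj]

/-- Subgraphs of a copy having an edge satisfy the weak form of the balance inequality. -/
lemma copy_weak (hE : IsBalancedFamily ℓ m E) (φ : X ↪ V) {S : Finset V}
    {Q : Finset (Finset V)} (hQ : Q ⊆ copyEdges E φ) (hne : Q.Nonempty) (hS : ∀ a ∈ Q, a ⊆ S)
    (hSφ : S ⊆ univ.map φ) : m * ℓ - 1 ≤ m * #S - #Q := by
  rcases hE.copy_trichotomy φ hQ hne hS hSφ with h | ⟨h1, h2⟩ | h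
  · have : #S = ℓ := hE.card_of_mem_copyEdges (hQ (h ▸ mem_singleton_self S))
    rw [h, this]; simp
  · rw [h1, h2, card_map, card_copyEdges, card_univ, hE.whole]
  · exact h.le

/-- The vertices of an edge `a` covered by the other edges outnumber every intersection of two
distinct edges: two edges sharing `|b ∩ b'|` vertices force `m (ℓ - |b ∩ b'|) > 1`, whereas
deleting `a` and its private vertices gives `m (ℓ - |a ∩ ⋃ (E \ a)|) < 1`. -/
lemma card_inter_lt (hE : IsBalancedFamily ℓ m E) (h3 : 3 ≤ #E) {a b b' : Finset X} (ha : a ∈ E)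
    (hb : b ∈ E) (hb' : b' ∈ E) (hne : b ≠ b') :
    #(b ∩ b') < #(a ∩ (E.erase a).biUnion id) := by
  have h1 : m * ℓ - 1 < m * #(b ∪ b') - #({b, b'} : Finset (Finset X)) := by
    refine hE.strict _ _ (by simp [insert_subset_iff, hb, hb']) (by simp) ?_
      (Or.inr ?_)
    · exact lt_card_of_ne (hE.card_edge b hb) (hE.card_edge b' hb') hne subset_union_left
        subset_union_right
    · intro h; rw [← h, card_pair hne] at h3; omega
  rw [card_pair hne] at h1
  set S := (E.erase a).biUnion id with hS
  have hcE : #(E.erase a) = #E - 1 := card_erase_of_mem ha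
  have h2 : m * ℓ - 1 < m * #S - #(E.erase a) := by
    refine hE.strict _ _ (erase_subset _ _) (fun c hc => subset_biUnion_of_mem id hc) ?_
      (Or.inr ?_)
    · obtain ⟨c, hc, d, hd, hcd⟩ := one_lt_card.1 (show 1 < #(E.erase a) by omega)
      exact lt_card_of_ne (hE.card_edge c (mem_of_mem_erase hc))
        (hE.card_edge d (mem_of_mem_erase hd)) hcd (subset_biUnion_of_mem id hc)
        (subset_biUnion_of_mem id hd)
    · intro h; rw [h] at hcE; omega
  have h4 : #(b ∪ b') + #(b ∩ b') = ℓ + ℓ := by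
    rw [card_union_add_card_inter, hE.card_edge b hb, hE.card_edge b' hb']
  have h5 : #(a ∪ S) + #(a ∩ S) = ℓ + #S := by
    rw [card_union_add_card_inter, hE.card_edge a ha]
  have h6 : #(a ∪ S) ≤ Fintype.card X := card_le_univ _
  have hw := hE.whole
  have hm := hE.pos
  have hcE' : (#(E.erase a) : ℝ) = #E - 1 := by
    rw [hcE, Nat.cast_sub (by omega)]; simp
  have h6' : m * (#(a ∪ S) : ℝ) ≤ m * Fintype.card X :=
    mul_le_mul_of_nonneg_left (by exact_mod_cast h6) hm.le
  have h7 : (S.card : ℝ) + ℓ = #(a ∪ S) + #(a ∩ S) := by exact_mod_cast (by omega)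
  have h8 : (#(b ∪ b') : ℝ) + #(b ∩ b') = ℓ + ℓ := by exact_mod_cast h4
  have h9 : m * ((Fintype.card X : ℝ) - #S) < 1 := by rw [hcE'] at h2; nlinarith
  have h10 : m * ((ℓ : ℝ) - #(b ∩ b')) > 1 := by push_cast at h1; nlinarith
  have h11 : m * ((ℓ : ℝ) - #(a ∩ S)) < 1 := by nlinarith
  have h12 : m * (#(b ∩ b') : ℝ) < m * #(a ∩ S) := by nlinarith
  exact_mod_cast lt_of_mul_lt_mul_left h12 hm.le

/-- Every vertex is covered by an edge, since isolated vertices could be deleted. -/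
lemma biUnion_eq_univ (hE : IsBalancedFamily ℓ m E) (h2 : 2 ≤ #E) : E.biUnion id = univ := by
  by_contra h
  obtain ⟨c, hc, d, hd, hcd⟩ := one_lt_card.1 (show 1 < #E by omega)
  have h1 := hE.strict (E.biUnion id) E subset_rfl (fun c hc => subset_biUnion_of_mem id hc)
    (lt_card_of_ne (hE.card_edge c hc) (hE.card_edge d hd) hcd (subset_biUnion_of_mem id hc)
        (subset_biUnion_of_mem id hd)) (Or.inl h)
  have hw := hE.whole
  have h6 : (#(E.biUnion id) : ℝ) ≤ Fintype.card X := by exact_mod_cast card_le_univ _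
  nlinarith [hE.pos]

/-- The vertices of a copy are covered by its edges. -/
lemma biUnion_copyEdges (hE : IsBalancedFamily ℓ m E) (h2 : 2 ≤ #E) (φ : X ↪ V) :
    (copyEdges E φ).biUnion id = univ.map φ := by
  rw [← hE.biUnion_eq_univ h2]
  ext v
  simp only [mem_biUnion, mem_copyEdges, id, mem_map]
  constructor
  · rintro ⟨_, ⟨a, ha, rfl⟩, hv⟩
    obtain ⟨x, hx, rfl⟩ := mem_map.1 hv
    exact ⟨x, ⟨a, ha, hx⟩, rfl⟩
  · rintro ⟨x, ⟨a, ha, hx⟩, rfl⟩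
    exact ⟨_, ⟨a, ha, rfl⟩, mem_map_of_mem _ hx⟩

/-- `card_inter_lt` inside a copy. -/
lemma copy_card_inter_lt (hE : IsBalancedFamily ℓ m E) (h3 : 3 ≤ #E) {b b' : Finset X}
    (φ : X ↪ V) {e : Finset V} (he : e ∈ copyEdges E φ)
    (hb : b ∈ E) (hb' : b' ∈ E) (hne : b ≠ b') :
    #(b ∩ b') < #(e ∩ ((copyEdges E φ).erase e).biUnion id) := by
  obtain ⟨a, ha, rfl⟩ := mem_copyEdges.1 he
  have h : (copyEdges E φ).erase (a.map φ) = (E.erase a).image (Finset.map φ) := by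
    rw [image_erase (Finset.map_injective φ), copyEdges]
  have h' : ((E.erase a).image (Finset.map φ)).biUnion id = ((E.erase a).biUnion id).map φ := by
    ext v; simp only [mem_biUnion, mem_image, id, mem_map]
    constructor
    · rintro ⟨_, ⟨c, hc, rfl⟩, hv⟩
      obtain ⟨x, hx, rfl⟩ := mem_map.1 hv
      exact ⟨x, ⟨c, hc, hx⟩, rfl⟩
    · rintro ⟨x, ⟨c, hc, hx⟩, rfl⟩
      exact ⟨_, ⟨c, hc, rfl⟩, mem_map_of_mem _ hx⟩
  rw [h, h', ← map_inter, card_map]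
  exact hE.card_inter_lt h3 ha hb hb' hne

/-- **Exchange.** Suppose that the copy `φ` meets the family `R` only inside its edge `e`. Then a
copy `ψ` inside `R ∪ φ` which uses another edge of `φ` uses all of them, and its only remaining
edge meets these edges in the same set as `e`. Adding up the balance inequalities of the part of
`ψ` inside `φ`, completed by `e`, and of the part outside leaves no slack. -/
lemma exchange (hE : IsBalancedFamily ℓ m E) {φ ψ : X ↪ V} {e : Finset V} {R : Finset (Finset V)}
    (he : e ∈ copyEdges E φ) (hR : ∀ r ∈ R, r ∩ univ.map φ ⊆ e)
    (hψ : ∀ g ∈ copyEdges E ψ, g ∈ R ∨ g ∈ copyEdges E φ) (h2 : 2 ≤ #E)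
    (hmeet : ∃ g ∈ copyEdges E ψ, g ∈ copyEdges E φ ∧ g ≠ e) :
    ∃ e₁, (e₁ ∈ R ∨ e₁ = e) ∧ copyEdges E ψ = insert e₁ ((copyEdges E φ).erase e) ∧
      e₁ ∩ ((copyEdges E φ).erase e).biUnion id = e ∩ ((copyEdges E φ).erase e).biUnion id := by
  set Eφ := copyEdges E φ with hEφ
  set Eψ := copyEdges E ψ with hEψ
  have hcφ : #Eφ = #E := card_copyEdges E φ
  have hcψ : #Eψ = #E := card_copyEdges E ψ
  set E2 := Eψ ∩ Eφ.erase e with hE2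
  set E1 := Eψ \ Eφ.erase e with hE1
  have hE2ne : E2.Nonempty := by
    obtain ⟨g, hg, hg', hge⟩ := hmeet
    exact ⟨g, mem_inter.2 ⟨hg, mem_erase.2 ⟨hge, hg'⟩⟩⟩
  have hcard : #E1 + #E2 = #E := by
    rw [hE1, hE2, card_sdiff_add_card_inter, hcψ]
  have hE2le : #E2 ≤ #E - 1 := by
    rw [← hcφ, ← card_erase_of_mem he]; exact card_le_card inter_subset_right
  have hE1ne : E1.Nonempty := card_pos.1 (by omega)
  set V1 := E1.biUnion id with hV1
  set V2 := E2.biUnion id with hV2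
  have hE1mem : ∀ g ∈ E1, g ∈ R ∨ g = e := by
    intro g hg
    obtain ⟨hg, hg'⟩ := mem_sdiff.1 hg
    rcases hψ g hg with h | h
    · exact Or.inl h
    · right; by_contra hne; exact hg' (mem_erase.2 ⟨hne, h⟩)
  have hV2φ : V2 ⊆ univ.map φ := biUnion_subset.2 fun g hg =>
    subset_of_mem_copyEdges (mem_of_mem_erase (mem_inter.1 hg).2)
  have hV12 : V1 ∩ V2 ⊆ V2 ∩ e := by
    intro x hx
    obtain ⟨hx1, hx2⟩ := mem_inter.1 hx
    refine mem_inter.2 ⟨hx2, ?_⟩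
    obtain ⟨g, hg, hxg⟩ := mem_biUnion.1 hx1
    rcases hE1mem g hg with h | h
    · exact hR g h (mem_inter.2 ⟨hxg, hV2φ hx2⟩)
    · exact h ▸ hxg
  have hV : V1 ∪ V2 = univ.map ψ := by
    rw [hV1, hV2, ← union_biUnion, hE1, hE2, sdiff_union_inter, hEψ, hE.biUnion_copyEdges h2]
  -- the two pieces
  have t1 := hE.copy_trichotomy ψ (S := V1) (Q := E1) sdiff_subset hE1ne
    (fun a ha => subset_biUnion_of_mem id ha) (hV ▸ subset_union_left)
  have w1 := hE.copy_weak ψ (S := V1) (Q := E1) sdiff_subset hE1ne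
    (fun a ha => subset_biUnion_of_mem id ha) (hV ▸ subset_union_left)
  have hins : insert e E2 ⊆ Eφ := insert_subset he (inter_subset_right.trans (erase_subset _ _))
  have hinsS : ∀ a ∈ insert e E2, a ⊆ V2 ∪ e := by
    intro a ha
    rcases mem_insert.1 ha with rfl | ha
    · exact subset_union_right
    · exact (subset_biUnion_of_mem id ha).trans subset_union_left
  have hVe : V2 ∪ e ⊆ univ.map φ := union_subset hV2φ (subset_of_mem_copyEdges he)
  have t2 := hE.copy_trichotomy φ (S := V2 ∪ e) hins (insert_nonempty _ _) hinsS hVe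
  have w2 := hE.copy_weak φ (S := V2 ∪ e) hins (insert_nonempty _ _) hinsS hVe
  have heE2 : e ∉ E2 := fun h => notMem_erase e Eφ (mem_inter.1 h).2
  rw [card_insert_of_notMem heE2] at t2 w2
  have c1 : (#(V1 ∩ V2) : ℝ) ≤ #(V2 ∩ e) := by exact_mod_cast card_le_card hV12
  have c2 : (#(V1 ∪ V2) : ℝ) + #(V1 ∩ V2) = #V1 + #V2 := by
    exact_mod_cast card_union_add_card_inter V1 V2
  have c3 : (#(V2 ∪ e) : ℝ) + #(V2 ∩ e) = #V2 + ℓ := by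
    rw [← hE.card_of_mem_copyEdges he]
    exact_mod_cast card_union_add_card_inter V2 e
  have c4 : (#(V1 ∪ V2) : ℝ) = Fintype.card X := by rw [hV, card_map, card_univ]
  have c5 : (#E1 : ℝ) + #E2 = #E := by exact_mod_cast hcard
  have hw := hE.whole
  have hm := hE.pos
  push_cast at t2 w2
  have c6 : m * (#(V1 ∩ V2) : ℝ) ≤ m * #(V2 ∩ e) := mul_le_mul_of_nonneg_left c1 hm.le
  have d2 : m * (#(V1 ∪ V2) : ℝ) + m * #(V1 ∩ V2) = m * #V1 + m * #V2 := by
    rw [← mul_add, c2, mul_add]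
  have d3 : m * (#(V2 ∪ e) : ℝ) + m * #(V2 ∩ e) = m * #V2 + m * ℓ := by
    rw [← mul_add, c3, mul_add]
  rw [c4] at d2
  have hE2eq : E2 = Eφ.erase e := by
    rcases t2 with h | ⟨-, h⟩ | h
    · obtain ⟨g, hg⟩ := hE2ne
      have h1 : g = V2 ∪ e := mem_singleton.1 (h ▸ mem_insert_of_mem hg)
      have h2 : e = V2 ∪ e := mem_singleton.1 (h ▸ mem_insert_self e E2)
      exact absurd ((h1.trans h2.symm) ▸ hg) heE2
    · exact (erase_insert heE2).symm.trans (by rw [h])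
    · linarith
  have hE1eq : E1 = {V1} := by
    rcases t1 with h | ⟨-, h⟩ | h
    · exact h
    · exfalso
      have : #E1 = #E := by rw [h, hcψ]
      have := card_pos.2 hE2ne
      omega
    · linarith
  have c7 : (#(V2 ∩ e) : ℝ) ≤ #(V1 ∩ V2) := by
    have : m * (#(V2 ∩ e) : ℝ) ≤ m * #(V1 ∩ V2) := by linarith
    exact le_of_mul_le_mul_left this hm
  have hV12' : V1 ∩ V2 = V2 ∩ e := eq_of_subset_of_card_le hV12 (by exact_mod_cast c7)
  refine ⟨V1, hE1mem V1 (hE1eq ▸ mem_singleton_self V1), ?_, ?_⟩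
  · rw [← hE2eq, insert_eq, ← hE1eq, hE1, hE2, sdiff_union_inter]
  · rw [← hE2eq, ← hV2, hV12', inter_comm]

end IsBalancedFamily

end

/-! ### Explorations of blocks -/

section

variable {X V : Type*} [DecidableEq V]

/-- The edge set `B` of an `F`-block. The copies are given by embeddings of the vertex set, and `γ`
is the maximal intersection of two edges; in the case `γ = ℓ - 1` an edge is closed if it lies in a
second copy. In the other case only the part of the definition of a closed edge is kept which
says that the edge is separated by copies from all other edges. -/
structure IsBlockFamily (ℓ γ : ℕ) (E : Finset (Finset X)) (B : Finset (Finset V)) : Prop where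
  closed : ∀ φ : X ↪ V, copyEdges E φ ⊆ B → ∃ C ⊆ copyEdges E φ, 3 ≤ #C ∧ ∀ g ∈ C,
    (γ = ℓ - 1 → ∃ ψ : X ↪ V, copyEdges E ψ ⊆ B ∧ g ∈ copyEdges E ψ ∧
      copyEdges E ψ ≠ copyEdges E φ) ∧
    (γ ≠ ℓ - 1 → ∀ g' ∈ B, g' ≠ g → ∃ ψ : X ↪ V, copyEdges E ψ ⊆ B ∧
      ¬ (g ∈ copyEdges E ψ ↔ g' ∈ copyEdges E ψ))
  connected : ∀ E' : Finset (Finset V), E'.Nonempty → E' ⊂ B →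
    ∃ ψ : X ↪ V, copyEdges E ψ ⊆ B ∧ (copyEdges E ψ ∩ E').Nonempty ∧ ¬ copyEdges E ψ ⊆ E'
  mem_copy : ∀ e ∈ B, ∃ ψ : X ↪ V, copyEdges E ψ ⊆ B ∧ e ∈ copyEdges E ψ

/-- The edges of the first `i` copies of a sequence. -/
def edgesBefore (E : Finset (Finset X)) (φ : ℕ → X ↪ V) (i : ℕ) : Finset (Finset V) :=
  (range i).biUnion fun k => copyEdges E (φ k)

/-- The vertices of the first `i` copies of a sequence. -/
def vertsBefore [Fintype X] (φ : ℕ → X ↪ V) (i : ℕ) : Finset V :=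
  (range i).biUnion fun k => univ.map (φ k)

/-- The copy `φ` is attached regularly at the edge `e` to the graph with vertex set `S` and edge
set `G`: it meets this graph exactly in `e`. -/
def IsRegularAt [Fintype X] (E : Finset (Finset X)) (S : Finset V) (G : Finset (Finset V)) (φ : X ↪ V)
    (e : Finset V) : Prop :=
  copyEdges E φ ∩ G = {e} ∧ univ.map φ ∩ S = e

/-- An exploration of `B` by the `F`-copies `φ 0, …, φ (N - 1)`. Each copy is new and shares an edge
with the earlier copy of index `ptr i`; the pointer never decreases, and all copies of `B` sharing
an edge with a copy before the pointer have been explored. -/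
structure IsExploration (E : Finset (Finset X)) (B : Finset (Finset V)) (N : ℕ)
    (φ : ℕ → X ↪ V) (ptr : ℕ → ℕ) : Prop where
  sub : ∀ i < N, copyEdges E (φ i) ⊆ B
  ptr_zero : ptr 0 = 0
  ptr_lt : ∀ i < N, 0 < i → ptr i < i
  mono : ∀ i j, i ≤ j → j < N → ptr i ≤ ptr j
  shares : ∀ i < N, 0 < i → (copyEdges E (φ i) ∩ copyEdges E (φ (ptr i))).Nonempty
  new : ∀ i < N, 0 < i → ¬ copyEdges E (φ i) ⊆ edgesBefore E φ i
  exhausted : ∀ i < N, ∀ k < ptr i, ∀ ψ : X ↪ V, copyEdges E ψ ⊆ B →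
    (copyEdges E ψ ∩ copyEdges E (φ k)).Nonempty → copyEdges E ψ ⊆ edgesBefore E φ i

section

variable {E : Finset (Finset X)} {φ : ℕ → X ↪ V} {i j : ℕ}

lemma copyEdges_subset_edgesBefore (h : j < i) : copyEdges E (φ j) ⊆ edgesBefore E φ i :=
  subset_biUnion_of_mem (fun k => copyEdges E (φ k)) (mem_range.2 h)

lemma map_subset_vertsBefore [Fintype X] (h : j < i) : univ.map (φ j) ⊆ vertsBefore φ i :=
  subset_biUnion_of_mem (fun k => univ.map (φ k)) (mem_range.2 h)

lemma subset_vertsBefore [Fintype X] {e : Finset V} (he : e ∈ edgesBefore E φ i) : e ⊆ vertsBefore φ i := by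
  obtain ⟨k, hk, he⟩ := mem_biUnion.1 he
  exact (subset_of_mem_copyEdges he).trans (map_subset_vertsBefore (mem_range.1 hk))

lemma edgesBefore_succ : edgesBefore E φ (i + 1) = copyEdges E (φ i) ∪ edgesBefore E φ i := by
  rw [edgesBefore, range_add_one, biUnion_insert, edgesBefore]

end

variable [Fintype X] {ℓ γ : ℕ} {m : ℝ} {E : Finset (Finset X)} {B : Finset (Finset V)} {N : ℕ}
  {φ : ℕ → X ↪ V} {ptr : ℕ → ℕ}

/-- In the case `γ = ℓ - 1`, an edge having the same traces as `e` on the other edges of a copy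
is `e` itself. -/
lemma IsBalancedFamily.eq_of_inter_eq (hE : IsBalancedFamily ℓ m E) {ψ : X ↪ V} {e e₁ : Finset V}
    (he : e ∈ copyEdges E ψ) (he₁ : #e₁ = ℓ) {U : Finset V} (hγ : ℓ - 1 < #(e ∩ U))
    (h : e₁ ∩ U = e ∩ U) : e₁ = e := by
  have hc := hE.card_of_mem_copyEdges he
  have h1 : e ∩ U = e := eq_of_subset_of_card_le inter_subset_left (by omega)
  have h2 : e ⊆ e₁ := h1 ▸ h ▸ inter_subset_left
  exact (eq_of_subset_of_card_le h2 (by omega)).symm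

variable [DecidableEq X]

/-- A regular copy which is missed by all degenerate steps has two new edges at which later copies
are attached regularly. Otherwise let `P` be the set of its new edges at which nothing is attached.
By the exchange lemma, no copy separates the edges of `P`, and each copy meeting `P` is the given
one if `γ = ℓ - 1`; this holds until all copies meeting the given one are explored. -/
lemma two_le_card_attached (hE : IsBalancedFamily ℓ m E) (h2 : 2 ≤ #E)
    (hcase : (γ = ℓ - 1 ∧ 3 ≤ #E) ∨ 4 ≤ #E)
    (hγ : ∀ a ∈ E, ∀ b ∈ E, a ≠ b → #(a ∩ b) ≤ γ)
    (hcov : ∀ (ψ : X ↪ V), ∀ e ∈ copyEdges E ψ,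
      γ < #(e ∩ ((copyEdges E ψ).erase e).biUnion id))
    (hB : IsBlockFamily ℓ γ E B) (hX : IsExploration E B N φ ptr) (hN : edgesBefore E φ N = B)
    {j : ℕ} (hj0 : 0 < j) (hjN : j < N) {e : Finset V}
    (hreg : IsRegularAt E (vertsBefore φ j) (edgesBefore E φ j) (φ j) e)
    {A : Finset (Finset V)}
    (hA : ∀ k < N, j < k → ∀ h, IsRegularAt E (vertsBefore φ k) (edgesBefore E φ k) (φ k) h →
      h ∈ A)
    (hhit : ∀ k < N, j < k →
      (¬ ∃ h, IsRegularAt E (vertsBefore φ k) (edgesBefore E φ k) (φ k) h) →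
      Disjoint (univ.map (φ k)) (univ.map (φ j) \ e) ∧ ptr k ≠ j) :
    2 ≤ #((copyEdges E (φ j)).erase e ∩ A) := by
  by_contra! hlt
  set P := (copyEdges E (φ j)).erase e \ A with hP
  have hej : e ∈ copyEdges E (φ j) := (mem_inter.1 (hreg.1 ▸ mem_singleton_self e)).1
  have hPj : P ⊆ copyEdges E (φ j) := sdiff_subset.trans (erase_subset _ _)
  -- new vertices of `φ j`
  have hU : ∀ x ∈ univ.map (φ j), x ∈ vertsBefore φ j → x ∈ e := fun x hx hx' =>
    hreg.2 ▸ mem_inter.2 ⟨hx, hx'⟩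
  have ptr_lt_of_le : ∀ k ≤ j, ptr k < j := fun k hk =>
    (hX.mono k j hk hjN).trans_lt (hX.ptr_lt j hjN hj0)
  -- a regular step uses an edge of the copy at its pointer
  have reg_mem : ∀ k < N, 0 < k → ∀ h,
      IsRegularAt E (vertsBefore φ k) (edgesBefore E φ k) (φ k) h →
      h ∈ copyEdges E (φ (ptr k)) := by
    intro k hk hk0 h hh
    obtain ⟨x, hx⟩ := hX.shares k hk hk0
    obtain ⟨hx1, hx2⟩ := mem_inter.1 hx
    have : x ∈ copyEdges E (φ k) ∩ edgesBefore E φ k :=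
      mem_inter.2 ⟨hx1, copyEdges_subset_edgesBefore (hX.ptr_lt k hk hk0) hx2⟩
    rw [hh.1, mem_singleton] at this
    exact this ▸ hx2
  have inv : ∀ i, j < i → i ≤ N → (∀ k < i, ptr k ≤ j) → ∀ ψ : X ↪ V,
      copyEdges E ψ ⊆ edgesBefore E φ i → (copyEdges E ψ ∩ P).Nonempty →
      P ⊆ copyEdges E ψ ∧ (γ = ℓ - 1 → copyEdges E ψ = copyEdges E (φ j)) := by
    intro i hji
    induction i with
    | zero => omega
    | succ i ih =>
      intro hiN hptr ψ hψ hmeet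
      by_cases hph : ∀ k < i + 1, ptr k < j
      · -- before the pointer reaches `j`, the copy `φ j` meets the rest inside `e` only
        obtain ⟨x, hx⟩ := hmeet
        obtain ⟨hxψ, hxP⟩ := mem_inter.1 hx
        have hR : ∀ r ∈ edgesBefore E φ (i + 1) \ copyEdges E (φ j),
            r ∩ univ.map (φ j) ⊆ e := by
          intro r hr y hy
          obtain ⟨hr, hrj⟩ := mem_sdiff.1 hr
          obtain ⟨hyr, hyj⟩ := mem_inter.1 hy
          obtain ⟨k, hk, hrk⟩ := mem_biUnion.1 hr
          rw [mem_range] at hk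
          have hyk : y ∈ univ.map (φ k) := subset_of_mem_copyEdges hrk hyr
          rcases lt_trichotomy k j with hkj | rfl | hkj
          · exact hU y hyj (map_subset_vertsBefore hkj hyk)
          · exact absurd hrk hrj
          · by_cases hdeg : ∃ h, IsRegularAt E (vertsBefore φ k) (edgesBefore E φ k) (φ k) h
            · obtain ⟨h, hh⟩ := hdeg
              have hyh : y ∈ h := hh.2 ▸ mem_inter.2 ⟨hyk, map_subset_vertsBefore hkj hyj⟩
              refine hU y hyj (map_subset_vertsBefore (hph k hk) ?_)
              exact subset_of_mem_copyEdges (reg_mem k (by omega) (by omega) h hh) hyh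
            · by_contra hye
              exact disjoint_left.1 (hhit k (by omega) hkj hdeg).1 hyk (mem_sdiff.2 ⟨hyj, hye⟩)
        obtain ⟨e₁, he₁, hEq, htr⟩ := hE.exchange hej hR
          (fun g hg => by
            by_cases hgj : g ∈ copyEdges E (φ j)
            · exact Or.inr hgj
            · exact Or.inl (mem_sdiff.2 ⟨hψ hg, hgj⟩)) h2
          ⟨x, hxψ, hPj hxP, (mem_erase.1 (mem_sdiff.1 hxP).1).1⟩
        refine ⟨hEq ▸ sdiff_subset.trans (subset_insert _ _), fun hγℓ => ?_⟩
        have hee : e₁ = e := hE.eq_of_inter_eq hej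
          (hE.card_of_mem_copyEdges (φ := ψ) (hEq ▸ mem_insert_self _ _))
          (hγℓ ▸ hcov _ e hej) htr
        rw [hEq, hee, insert_erase hej]
      · -- the pointer is at `j`, and the last step is regular
        push Not at hph
        obtain ⟨k, hki, hkj⟩ := hph
        have hjk : j < k := by
          by_contra! h
          exact absurd (ptr_lt_of_le k h) (by omega)
        have hpi : ptr i = j := le_antisymm (hptr i (by omega))
          (hkj.trans (hX.mono k i (by omega) (by omega)))
        have hregi : ∃ h, IsRegularAt E (vertsBefore φ i) (edgesBefore E φ i) (φ i) h := by
          by_contra h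
          exact (hhit i (by omega) (by omega) h).2 hpi
        obtain ⟨h, hh⟩ := hregi
        have hhj : h ∈ copyEdges E (φ j) := hpi ▸ reg_mem i (by omega) (by omega) h hh
        have hhA : h ∈ A := hA i (by omega) (by omega) h hh
        have hhP : h ∉ P := fun hp => (mem_sdiff.1 hp).2 hhA
        have hhi : h ∈ copyEdges E (φ i) ∧ h ∈ edgesBefore E φ i :=
          mem_inter.1 (hh.1 ▸ mem_singleton_self h)
        by_cases hold : copyEdges E ψ ⊆ edgesBefore E φ i
        · exact ih (by omega) (by omega) (fun k hk => hptr k (by omega)) ψ hold hmeet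
        exfalso
        obtain ⟨g, hgψ, hgold⟩ := not_subset.1 hold
        rw [edgesBefore_succ] at hψ
        have hgi : g ∈ copyEdges E (φ i) := by
          rcases mem_union.1 (hψ hgψ) with h' | h'
          · exact h'
          · exact absurd h' hgold
        obtain ⟨e₁, -, hEq, htr⟩ := hE.exchange (R := edgesBefore E φ i) hhi.1
          (fun r hr y hy => hh.2 ▸ mem_inter.2 ⟨(mem_inter.1 hy).2,
            subset_vertsBefore hr (mem_inter.1 hy).1⟩)
          (fun g hg => (mem_union.1 (hψ hg)).symm) h2
          ⟨g, hgψ, hgi, fun h' => hgold (h' ▸ hhi.2)⟩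
        obtain ⟨x, hx⟩ := hmeet
        obtain ⟨hxψ, hxP⟩ := mem_inter.1 hx
        rw [hEq, mem_insert] at hxψ
        rcases hxψ with rfl | hxψ
        · obtain ⟨a, ha, rfl⟩ := mem_copyEdges.1 (hPj hxP)
          obtain ⟨b, hb, rfl⟩ := mem_copyEdges.1 hhj
          have hab : a ≠ b := fun h' => hhP (h' ▸ hxP)
          have hle := hγ a ha b hb hab
          have hlt' := hcov (φ i) _ hhi.1
          rw [← card_map (φ j), map_inter] at hle
          have hsub := card_le_card (subset_inter (htr ▸ inter_subset_left :
            b.map (φ j) ∩ _ ⊆ a.map (φ j)) inter_subset_left)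
          omega
        · have : x ∈ copyEdges E (φ i) ∩ edgesBefore E φ i :=
            mem_inter.2 ⟨mem_of_mem_erase hxψ, copyEdges_subset_edgesBefore (by omega) (hPj hxP)⟩
          rw [hh.1, mem_singleton] at this
          exact hhP (this ▸ hxP)
  -- all copies of `B` meeting `φ j` are explored while the pointer is at most `j`
  have fin : ∀ ψ : X ↪ V, copyEdges E ψ ⊆ B → (copyEdges E ψ ∩ P).Nonempty →
      P ⊆ copyEdges E ψ ∧ (γ = ℓ - 1 → copyEdges E ψ = copyEdges E (φ j)) := by
    intro ψ hψ hmeet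
    by_cases hall : ∀ k < N, ptr k ≤ j
    · exact inv N hjN le_rfl hall ψ (hN ▸ hψ) hmeet
    · have hex : ∃ k, k < N ∧ j < ptr k := by push Not at hall; exact hall
      classical
      obtain ⟨h1, h3⟩ := Nat.find_spec hex
      refine inv (Nat.find hex) ?_ h1.le (fun k hk => ?_) ψ ?_ hmeet
      · by_contra! h
        exact absurd (ptr_lt_of_le _ h) (by omega)
      · have := Nat.find_min hex hk
        push Not at this
        exact this (by omega)
      · exact hX.exhausted _ h1 j h3 ψ hψ (hmeet.mono (inter_subset_inter_left hPj))
  obtain ⟨C, hC, hC3, hCcl⟩ := hB.closed (φ j) (hX.sub j hjN)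
  -- some closed edge lies in `P`
  have hgP : ∃ g ∈ C, g ∈ P := by
    by_contra! hno
    have : C ⊆ insert e ((copyEdges E (φ j)).erase e ∩ A) := by
      intro g hg
      by_cases hge : g = e
      · exact hge ▸ mem_insert_self _ _
      · have h1 : g ∈ (copyEdges E (φ j)).erase e := mem_erase.2 ⟨hge, hC hg⟩
        refine mem_insert_of_mem (mem_inter.2 ⟨h1, ?_⟩)
        by_contra hgA
        exact hno g hg (mem_sdiff.2 ⟨h1, hgA⟩)
    have := (card_le_card this).trans (card_insert_le _ _)
    omega
  obtain ⟨g, hgC, hgP⟩ := hgP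
  by_cases hγℓ : γ = ℓ - 1
  · obtain ⟨ψ, hψB, hgψ, hne⟩ := (hCcl g hgC).1 hγℓ
    exact hne ((fin ψ hψB ⟨g, mem_inter.2 ⟨hgψ, hgP⟩⟩).2 hγℓ)
  · have h4 : 4 ≤ #E := by tauto
    have hPc : 1 < #P := by
      have h5 : #P + #((copyEdges E (φ j)).erase e ∩ A) = #((copyEdges E (φ j)).erase e) :=
        card_sdiff_add_card_inter _ _
      have h6 := card_erase_add_one hej
      rw [card_copyEdges] at h6
      omega
    obtain ⟨g', hg'P, hne⟩ := exists_mem_ne hPc g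
    obtain ⟨ψ, hψB, hsep⟩ := (hCcl g hgC).2 hγℓ g' (hX.sub j hjN (hPj hg'P)) hne
    refine hsep ⟨fun h => ?_, fun h => ?_⟩
    · exact (fin ψ hψB ⟨g, mem_inter.2 ⟨h, hgP⟩⟩).1 hg'P
    · exact (fin ψ hψB ⟨g', mem_inter.2 ⟨h, hg'P⟩⟩).1 hgP

open Classical in
/-- A complete exploration of a block with `d` degenerate steps has boundedly many steps in terms of
`d`: every regular copy missed by the degenerate steps has two edges of its own at which copies are
attached, and each regular step provides one such edge. -/
theorem exploration_length_le (hE : IsBalancedFamily ℓ m E) (h2 : 2 ≤ #E)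
    (hcase : (γ = ℓ - 1 ∧ 3 ≤ #E) ∨ 4 ≤ #E)
    (hγ : ∀ a ∈ E, ∀ b ∈ E, a ≠ b → #(a ∩ b) ≤ γ)
    (hcov : ∀ (ψ : X ↪ V), ∀ e ∈ copyEdges E ψ,
      γ < #(e ∩ ((copyEdges E ψ).erase e).biUnion id))
    (hB : IsBlockFamily ℓ γ E B) (hX : IsExploration E B N φ ptr) (hN : edgesBefore E φ N = B) :
    N ≤ 1 + (2 * Fintype.card X + 3) * #{k ∈ Ico 1 N |
      ¬ ∃ h, IsRegularAt E (vertsBefore φ k) (edgesBefore E φ k) (φ k) h} := by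
  set reg : ℕ → Prop := fun k =>
    ∃ h, IsRegularAt E (vertsBefore φ k) (edgesBefore E φ k) (φ k) h with hreg
  set R := {k ∈ Ico 1 N | reg k} with hR
  set D := {k ∈ Ico 1 N | ¬ reg k} with hD
  have hRD : #R + #D = N - 1 := by
    rw [hR, hD, card_filter_add_card_filter_not, Nat.card_Ico]
  -- the attachment edge of a step
  let att : ℕ → Finset V := fun k => if h : reg k then h.choose else ∅
  have hatt : ∀ k, reg k → IsRegularAt E (vertsBefore φ k) (edgesBefore E φ k) (φ k) (att k) := by
    intro k hk
    simp only [att, dif_pos hk]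
    exact hk.choose_spec
  have att_unique : ∀ k h, IsRegularAt E (vertsBefore φ k) (edgesBefore E φ k) (φ k) h →
      h = att k := by
    intro k h hh
    rw [← hh.2, ← (hatt k ⟨h, hh⟩).2]
  have hRmem : ∀ k ∈ R, 0 < k ∧ k < N ∧ reg k := by
    intro k hk
    rw [hR, mem_filter, mem_Ico] at hk
    exact ⟨by omega, by omega, hk.2⟩
  have hDmem : ∀ k ∈ D, 0 < k ∧ k < N ∧ ¬ reg k := by
    intro k hk
    rw [hD, mem_filter, mem_Ico] at hk
    exact ⟨by omega, by omega, hk.2⟩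
  let U : ℕ → Finset V := fun j => univ.map (φ j) \ att j
  have hUdisj : ∀ j k, j < k → reg k → Disjoint (U j) (U k) := by
    intro j k hjk hk
    refine disjoint_left.2 fun x hxj hxk => (mem_sdiff.1 hxk).2 ?_
    have h1 := (hatt k hk).2
    rw [← h1]
    exact mem_inter.2 ⟨(mem_sdiff.1 hxk).1,
      map_subset_vertsBefore hjk (mem_sdiff.1 hxj).1⟩
  let hit : ℕ → Finset ℕ := fun k =>
    insert (ptr k) {j ∈ R | ¬ Disjoint (univ.map (φ k)) (U j)}
  have hhit : ∀ k, #(hit k) ≤ Fintype.card X + 1 := by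
    intro k
    refine (card_insert_le _ _).trans (Nat.add_le_add_right ?_ 1)
    rw [← card_univ, ← card_map (φ k)]
    refine card_le_card_of_forall_subsingleton (fun j x => x ∈ U j)
      (fun j hj => not_disjoint_iff.1 (mem_filter.1 hj).2) fun x _ => ?_
    rintro j ⟨hj, h1⟩ j' ⟨hj', h2⟩
    by_contra hne
    have hjR := (hRmem j (mem_filter.1 hj).1).2.2
    have hjR' := (hRmem j' (mem_filter.1 hj').1).2.2
    rcases lt_or_gt_of_ne hne with h | h
    · exact disjoint_left.1 (hUdisj j j' h hjR') h1 h2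
    · exact disjoint_left.1 (hUdisj j' j h hjR) h2 h1
  set R' := R \ D.biUnion hit with hR'
  have hR'card : #R ≤ #R' + #D * (Fintype.card X + 1) := by
    have h1 : #(D.biUnion hit) ≤ #D * (Fintype.card X + 1) :=
      card_biUnion_le_card_mul _ _ _ fun k _ => hhit k
    have h3 : #R ≤ #R' + #(D.biUnion hit) := by
      rw [hR']; have := le_card_sdiff (D.biUnion hit) R; omega
    omega
  set A := R.image att with hA
  have htwo : ∀ j ∈ R', 2 ≤ #((copyEdges E (φ j)).erase (att j) ∩ A) := by
    intro j hj
    obtain ⟨hjR, hjh⟩ := mem_sdiff.1 hj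
    obtain ⟨hj0, hjN, hjreg⟩ := hRmem j hjR
    refine two_le_card_attached hE h2 hcase hγ hcov hB hX hN hj0 hjN (hatt j hjreg) ?_ ?_
    · intro k hkN hjk h hh
      rw [att_unique k h hh]
      exact mem_image_of_mem _ (mem_filter.2 ⟨mem_Ico.2 ⟨by omega, hkN⟩, ⟨h, hh⟩⟩)
    · intro k hkN hjk hk
      have hkD : k ∈ D := mem_filter.2 ⟨mem_Ico.2 ⟨by omega, hkN⟩, hk⟩
      have hjk' : j ∉ hit k := fun h => hjh (mem_biUnion.2 ⟨k, hkD, h⟩)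
      constructor
      · by_contra hd
        exact hjk' (mem_insert_of_mem (mem_filter.2 ⟨hjR, hd⟩))
      · rintro rfl
        exact hjk' (mem_insert_self _ _)
  have hdisj : ∀ j k, j < k → reg k → ∀ x, x ∈ (copyEdges E (φ j)).erase (att j) →
      x ∉ (copyEdges E (φ k)).erase (att k) := by
    intro j k hjk hk x hxj hxk
    have : x ∈ copyEdges E (φ k) ∩ edgesBefore E φ k :=
      mem_inter.2 ⟨mem_of_mem_erase hxk, copyEdges_subset_edgesBefore hjk (mem_of_mem_erase hxj)⟩
    rw [(hatt k hk).1, mem_singleton] at this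
    exact (mem_erase.1 hxk).1 this
  have hsum : #R' * 2 ≤ #A := by
    calc #R' * 2 ≤ ∑ j ∈ R', #((copyEdges E (φ j)).erase (att j) ∩ A) := by
          rw [← smul_eq_mul]; exact card_nsmul_le_sum _ _ _ htwo
      _ = #(R'.biUnion fun j => (copyEdges E (φ j)).erase (att j) ∩ A) := by
          refine (card_biUnion fun j hj k hk hne => ?_).symm
          have hjr := (hRmem j (mem_sdiff.1 hj).1).2.2
          have hkr := (hRmem k (mem_sdiff.1 hk).1).2.2
          refine disjoint_left.2 fun x hx hx' => ?_
          have h1 := (mem_inter.1 hx).1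
          have h3 := (mem_inter.1 hx').1
          rcases lt_or_gt_of_ne hne with h | h
          · exact hdisj j k h hkr x h1 h3
          · exact hdisj k j h hjr x h3 h1
      _ ≤ #A := card_le_card (biUnion_subset.2 fun j _ => inter_subset_right)
  have hAR : #A ≤ #R := card_image_le
  have h7 : (2 * Fintype.card X + 3) * #D = 2 * (#D * (Fintype.card X + 1)) + #D := by ring
  rw [h7]
  omega

end

/-! ### Existence of explorations and their encoding by lists -/

section

variable {X V : Type*}

section

variable [DecidableEq V] {E : Finset (Finset X)} {B : Finset (Finset V)} {N : ℕ} {φ φ' : ℕ → X ↪ V} {ptr : ℕ → ℕ}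

lemma edgesBefore_mono {i j : ℕ} (h : i ≤ j) : edgesBefore E φ i ⊆ edgesBefore E φ j :=
  biUnion_subset_biUnion_of_subset_left _ (range_subset_range.2 h)

lemma edgesBefore_congr {i : ℕ} (h : ∀ k < i, φ k = φ' k) :
    edgesBefore E φ i = edgesBefore E φ' i :=
  biUnion_congr rfl fun k hk => by rw [h k (mem_range.1 hk)]

lemma IsExploration.edgesBefore_subset (hX : IsExploration E B N φ ptr) :
    edgesBefore E φ N ⊆ B :=
  biUnion_subset.2 fun k hk => hX.sub k (mem_range.1 hk)

/-- An incomplete exploration of a block can be continued, at the first copy which some unexplored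
copy shares an edge with. -/
lemma IsExploration.exists_succ {ℓ γ : ℕ} (hB : IsBlockFamily ℓ γ E B)
    (hX : IsExploration E B N φ ptr) (hne : (edgesBefore E φ N).Nonempty)
    (hN : edgesBefore E φ N ≠ B) : ∃ φ' ptr', IsExploration E B (N + 1) φ' ptr' := by
  classical
  have hex : ∃ k, k < N ∧ ∃ ψ : X ↪ V, copyEdges E ψ ⊆ B ∧
      (copyEdges E ψ ∩ copyEdges E (φ k)).Nonempty ∧ ¬ copyEdges E ψ ⊆ edgesBefore E φ N := by
    obtain ⟨ψ, hψ, ⟨x, hx⟩, hnot⟩ := hB.connected _ hne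
      (Finset.ssubset_iff_subset_ne.2 ⟨hX.edgesBefore_subset, hN⟩)
    obtain ⟨k, hk, hxk⟩ := mem_biUnion.1 (mem_inter.1 hx).2
    exact ⟨k, mem_range.1 hk, ψ, hψ, ⟨x, mem_inter.2 ⟨(mem_inter.1 hx).1, hxk⟩⟩, hnot⟩
  obtain ⟨hjN, ψ, hψB, hψj, hψnot⟩ := Nat.find_spec hex
  set j := Nat.find hex with hj
  have hexh : ∀ k < j, ∀ χ : X ↪ V, copyEdges E χ ⊆ B →
      (copyEdges E χ ∩ copyEdges E (φ k)).Nonempty → copyEdges E χ ⊆ edgesBefore E φ N := by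
    intro k hk χ hχ hχk
    by_contra hnot
    exact Nat.find_min hex hk ⟨by omega, χ, hχ, hχk, hnot⟩
  have hptr : ∀ k < N, ptr k ≤ j := by
    intro k hk
    by_contra! hlt
    exact hψnot ((hX.exhausted k hk j hlt ψ hψB hψj).trans (edgesBefore_mono hk.le))
  have hφ : ∀ k < N, Function.update φ N ψ k = φ k := fun k hk =>
    Function.update_of_ne hk.ne _ _
  have hp : ∀ k < N, Function.update ptr N j k = ptr k := fun k hk =>
    Function.update_of_ne hk.ne _ _
  have hG : ∀ i ≤ N, edgesBefore E (Function.update φ N ψ) i = edgesBefore E φ i := fun i hi =>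
    edgesBefore_congr fun k hk => hφ k (by omega)
  have hN0 : 0 < N := by
    obtain ⟨x, hx⟩ := hne
    obtain ⟨k, hk, -⟩ := mem_biUnion.1 hx
    exact (Nat.zero_le k).trans_lt (mem_range.1 hk)
  refine ⟨Function.update φ N ψ, Function.update ptr N j, ?_, (hp 0 hN0).trans hX.ptr_zero,
    ?_, ?_, ?_, ?_, ?_⟩
  · intro i hi
    rcases Nat.lt_succ_iff_lt_or_eq.1 hi with h | rfl
    · rw [hφ i h]; exact hX.sub i h
    · rwa [Function.update_self]
  · intro i hi hi0
    rcases Nat.lt_succ_iff_lt_or_eq.1 hi with h | rfl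
    · rw [hp i h]; exact hX.ptr_lt i h hi0
    · rwa [Function.update_self]
  · intro i k hik hk
    rcases Nat.lt_succ_iff_lt_or_eq.1 hk with h | rfl
    · rw [hp i (by omega), hp k h]; exact hX.mono i k hik h
    · rw [Function.update_self]
      rcases hik.lt_or_eq with h | rfl
      · rw [hp i h]; exact hptr i h
      · rw [Function.update_self]
  · intro i hi hi0
    rcases Nat.lt_succ_iff_lt_or_eq.1 hi with h | rfl
    · have := hX.ptr_lt i h hi0
      rw [hp i h, hφ i h, hφ _ (by omega)]; exact hX.shares i h hi0
    · rw [Function.update_self, Function.update_self, hφ _ hjN]; exact hψj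
  · intro i hi hi0
    rcases Nat.lt_succ_iff_lt_or_eq.1 hi with h | rfl
    · rw [hφ i h, hG i h.le]; exact hX.new i h hi0
    · rwa [Function.update_self, hG _ le_rfl]
  · intro i hi k hk χ hχ hχk
    rcases Nat.lt_succ_iff_lt_or_eq.1 hi with h | rfl
    · rw [hp i h] at hk
      have : ptr i ≤ j := hptr i h
      rw [hφ k (by omega)] at hχk
      rw [hG i h.le]; exact hX.exhausted i h k hk χ hχ hχk
    · rw [Function.update_self] at hk
      rw [hφ k (by omega)] at hχk
      rw [hG _ le_rfl]; exact hexh k hk χ hχ hχk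

/-- A block has explorations of any given length, unless a shorter one is complete. -/
lemma exists_exploration {ℓ γ : ℕ} (hE : E.Nonempty) (hB : IsBlockFamily ℓ γ E B)
    (hBne : B.Nonempty) {N : ℕ} (hN : 1 ≤ N) :
    (∃ φ ptr, IsExploration E B N φ ptr) ∨
      ∃ N' φ ptr, N' < N ∧ IsExploration E B N' φ ptr ∧ edgesBefore E φ N' = B := by
  induction N, hN using Nat.le_induction with
  | base =>
    left
    obtain ⟨e, he⟩ := hBne
    obtain ⟨ψ, hψ, -⟩ := hB.mem_copy e he
    refine ⟨fun _ => ψ, fun _ => 0, fun _ _ => hψ, rfl, ?_, fun _ _ _ _ => le_rfl, ?_, ?_, ?_⟩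
    · intro i h h'; omega
    · intro i h h'; omega
    · intro i h h'; omega
    · intro i h k hk; omega
  | succ N hN ih =>
    rcases ih with ⟨φ, ptr, hX⟩ | ⟨N', φ, ptr, hlt, hX⟩
    · by_cases hc : edgesBefore E φ N = B
      · exact Or.inr ⟨N, φ, ptr, by omega, hX, hc⟩
      · refine Or.inl (hX.exists_succ hB ?_ hc)
        have : (copyEdges E (φ 0)).Nonempty := hE.image _
        exact this.mono (copyEdges_subset_edgesBefore (by omega))
    · exact Or.inr ⟨N', φ, ptr, by omega, hX⟩

end

/-- All edges of a list of copies. The entries of the list, latest copy first, consist of a pointer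
and an embedding. -/
def listEdges [DecidableEq V] (E : Finset (Finset X)) : List (ℕ × (X ↪ V)) → Finset (Finset V)
  | [] => ∅
  | a :: l => copyEdges E a.2 ∪ listEdges E l

/-- All vertices of a list of copies. -/
def listVerts [DecidableEq V] [Fintype X] : List (ℕ × (X ↪ V)) → Finset V
  | [] => ∅
  | a :: l => univ.map a.2 ∪ listVerts l

open Classical in
/-- The number of degenerate steps, `0` or `1`, performed by attaching the copy `φ`. -/
noncomputable def degenCount [DecidableEq V] [Fintype X] (E : Finset (Finset X)) (S : Finset V)
    (G : Finset (Finset V)) (φ : X ↪ V) : ℕ :=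
  if ∃ h, IsRegularAt E S G φ h then 0 else 1

/-- The number of copies in a list which are not attached regularly to the preceding ones; this
includes the first copy. -/
noncomputable def listDegen [DecidableEq V] [Fintype X] (E : Finset (Finset X)) : List (ℕ × (X ↪ V)) → ℕ
  | [] => 0
  | a :: l => listDegen E l + degenCount E (listVerts l) (listEdges E l) a.2

/-- The last pointer of a list. -/
def listPtr : List (ℕ × (X ↪ V)) → ℕ
  | [] => 0
  | a :: _ => a.1

open Classical in
/-- The pairs of a pointer and a copy by which a list may be continued. -/
noncomputable def listNext [DecidableEq V] [Fintype X] [Fintype V] (E : Finset (Finset X)) :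
    List (ℕ × (X ↪ V)) → Finset (ℕ × (X ↪ V))
  | [] => {0} ×ˢ univ
  | a :: l => {b ∈ range (l.length + 1) ×ˢ univ | a.1 ≤ b.1 ∧
      (∃ c, (a :: l).reverse[b.1]? = some c ∧ (copyEdges E b.2 ∩ copyEdges E c.2).Nonempty) ∧
      ¬ copyEdges E b.2 ⊆ listEdges E (a :: l)}

open Classical in
/-- The lists of length `t` all of whose entries are allowed continuations in the sense of
`next`. -/
noncomputable def chains {α : Type*} (next : List α → Finset α) : ℕ → Finset (List α)
  | 0 => {[]}
  | t + 1 => (chains next t).biUnion fun l => (next l).image (· :: l)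

lemma length_of_mem_chains {α : Type*} {next : List α → Finset α} {t : ℕ}
    {l : List α} (h : l ∈ chains next t) : l.length = t := by
  induction t generalizing l with
  | zero => rw [chains, mem_singleton] at h; simp [h]
  | succ t ih =>
    simp only [chains, mem_biUnion, mem_image] at h
    obtain ⟨l', hl', a, -, rfl⟩ := h
    simp [ih hl']

lemma cons_mem_chains {α : Type*} {next : List α → Finset α} {t : ℕ} {l : List α} {a : α}
    (hl : l ∈ chains next t) (ha : a ∈ next l) : a :: l ∈ chains next (t + 1) := by
  simp only [chains, mem_biUnion, mem_image]
  exact ⟨l, hl, a, ha, rfl⟩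

open Classical in
/-- If each continuation step multiplies the total weight by at most `K`, then the total weight
of all chains decays geometrically. -/
lemma sum_chains_le {α : Type*} {next : List α → Finset α} {w : List α → ℝ}
    {K W : ℝ} (hK : 0 ≤ K) {T : ℕ}
    (h0 : ∑ a ∈ next [], w [a] ≤ W)
    (hstep : ∀ l, l ≠ [] → l.length < T → ∑ a ∈ next l, w (a :: l) ≤ K * w l) {t : ℕ}
    (ht : t < T) : ∑ l ∈ chains next (t + 1), w l ≤ W * K ^ t := by
  have hsum : ∀ t, ∑ l ∈ chains next (t + 1), w l ≤
      ∑ l ∈ chains next t, ∑ a ∈ next l, w (a :: l) := by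
    intro t
    rw [chains]
    rw [sum_biUnion]
    · refine sum_le_sum fun l _ => ?_
      rw [sum_image]
      intro a _ b _ h
      exact (List.cons.inj h).1
    · intro l _ l' _ hne
      refine disjoint_left.2 fun x hx hx' => hne ?_
      obtain ⟨a, -, rfl⟩ := mem_image.1 hx
      obtain ⟨b, -, h⟩ := mem_image.1 hx'
      exact (List.cons.inj h).2.symm
  induction t with
  | zero => refine (hsum 0).trans ?_; simpa [chains] using h0
  | succ t ih =>
    refine (hsum (t + 1)).trans ?_
    calc ∑ l ∈ chains next (t + 1), ∑ a ∈ next l, w (a :: l)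
        ≤ ∑ l ∈ chains next (t + 1), K * w l := by
          refine sum_le_sum fun l hl => hstep l ?_ ?_
          · rintro rfl
            have := length_of_mem_chains hl
            simp at this
          · rw [length_of_mem_chains hl]; exact ht
      _ = K * ∑ l ∈ chains next (t + 1), w l := by rw [mul_sum]
      _ ≤ K * (W * K ^ t) := mul_le_mul_of_nonneg_left (ih (by omega)) hK
      _ = W * K ^ (t + 1) := by ring

/-- The list of the first `N` copies of a sequence. -/
def seqList (φ : ℕ → X ↪ V) (ptr : ℕ → ℕ) : ℕ → List (ℕ × (X ↪ V))
  | 0 => []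
  | N + 1 => (ptr N, φ N) :: seqList φ ptr N

section

variable {E : Finset (Finset X)} {B : Finset (Finset V)} {φ : ℕ → X ↪ V} {ptr : ℕ → ℕ}

lemma length_seqList (N : ℕ) : (seqList φ ptr N).length = N := by
  induction N with
  | zero => rfl
  | succ N ih => simp [seqList, ih]

lemma reverse_seqList_getElem? {N j : ℕ} (h : j < N) :
    (seqList φ ptr N).reverse[j]? = some (ptr j, φ j) := by
  induction N with
  | zero => omega
  | succ N ih =>
    rw [seqList, List.reverse_cons]
    rcases Nat.lt_succ_iff_lt_or_eq.1 h with h' | rfl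
    · rw [List.getElem?_append_left (by simpa [length_seqList] using h'), ih h']
    · rw [List.getElem?_append_right (by simp [length_seqList])]
      simp [length_seqList]

variable [DecidableEq V]

lemma listEdges_seqList (N : ℕ) : listEdges E (seqList φ ptr N) = edgesBefore E φ N := by
  induction N with
  | zero => rfl
  | succ N ih => rw [seqList, listEdges, ih, edgesBefore_succ]

variable [Fintype X]

lemma listVerts_seqList (N : ℕ) : listVerts (seqList φ ptr N) = vertsBefore φ N := by
  induction N with
  | zero => rfl
  | succ N ih =>
    rw [seqList, listVerts, ih, vertsBefore, vertsBefore, range_add_one, biUnion_insert]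

open Classical in
lemma listDegen_seqList {N : ℕ} (hN : 1 ≤ N) :
    listDegen E (seqList φ ptr N) = 1 + #{k ∈ Ico 1 N |
      ¬ ∃ h, IsRegularAt E (vertsBefore φ k) (edgesBefore E φ k) (φ k) h} := by
  induction N, hN using Nat.le_induction with
  | base =>
    have : ¬ ∃ h, IsRegularAt E ∅ ∅ (φ 0) h := by
      rintro ⟨h, hh, -⟩
      rw [inter_empty] at hh
      exact singleton_ne_empty h hh.symm
    simp [seqList, listDegen, degenCount, listVerts, listEdges, this]
  | succ N hN ih =>
    rw [seqList, listDegen, degenCount, ih, listEdges_seqList, listVerts_seqList,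
      show Ico 1 (N + 1) = insert N (Ico 1 N) from Nat.Ico_succ_right_eq_insert_Ico hN,
      filter_insert]
    by_cases h : ∃ h, IsRegularAt E (vertsBefore φ N) (edgesBefore E φ N) (φ N) h
    · simp only [h, not_true, if_true, if_false, add_zero]
    · simp only [h, not_false_eq_true, if_true, if_false]
      rw [card_insert_of_notMem (by simp)]
      ring

variable [Fintype V]

lemma IsExploration.seqList_mem_chains {N : ℕ} (hX : IsExploration E B N φ ptr) {t : ℕ}
    (ht : t ≤ N) : seqList φ ptr t ∈ chains (listNext E) t := by
  induction t with
  | zero => simp [chains, seqList]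
  | succ t ih =>
    refine cons_mem_chains (ih (by omega)) ?_
    cases t with
    | zero => simp [seqList, listNext, hX.ptr_zero]
    | succ t =>
      have hlt := hX.ptr_lt (t + 1) (by omega) (by omega)
      have hG : listEdges E ((ptr t, φ t) :: seqList φ ptr t) = edgesBefore E φ (t + 1) :=
        listEdges_seqList (ptr := ptr) (t + 1)
      rw [seqList, listNext, mem_filter, mem_product, mem_range, hG, length_seqList]
      refine ⟨⟨hlt, mem_univ _⟩, hX.mono t (t + 1) (by omega) (by omega),
        ⟨(ptr (ptr (t + 1)), φ (ptr (t + 1))), ?_, hX.shares (t + 1) (by omega) (by omega)⟩,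
        hX.new (t + 1) (by omega) (by omega)⟩
      exact reverse_seqList_getElem? (N := t + 1) hlt

end

end

/-! ### The weight of one exploration step -/

section

lemma card_embedding_filter_le {X V : Type*} [Fintype X] [Fintype V] [DecidableEq X]
    [DecidableEq V] (S : Finset X) (A : Finset V) :
    #{φ : X ↪ V | ∀ x ∈ S, φ x ∈ A} ≤ #A ^ #S * Fintype.card V ^ (Fintype.card X - #S) := by
  classical
  have h1 : #{φ : X ↪ V | ∀ x ∈ S, φ x ∈ A} ≤
      #(Fintype.piFinset fun x : X => if x ∈ S then A else univ) := by
    refine card_le_card_of_injOn (fun φ => (φ : X → V)) (fun φ hφ => ?_)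
      (fun φ _ ψ _ h => DFunLike.coe_injective h)
    simp only [coe_filter, mem_univ, true_and, Set.mem_ofPred_eq] at hφ
    simp only [mem_coe, Fintype.mem_piFinset]
    intro x
    by_cases hx : x ∈ S
    · simpa [hx] using hφ x hx
    · simp [hx]
  refine h1.trans_eq ?_
  rw [Fintype.card_piFinset]
  have h2 : ∀ x, #(if x ∈ S then A else univ) = if x ∈ S then #A else Fintype.card V := by
    intro x; split_ifs <;> simp
  simp_rw [h2]
  rw [prod_ite, prod_const, prod_const, filter_mem_eq_inter, univ_inter, ← card_compl]
  congr 2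
  congr 1
  ext x; simp

variable {X V : Type*}

section

variable [DecidableEq V] {E : Finset (Finset X)}

lemma copyEdges_subset_listEdges {l : List (ℕ × (X ↪ V))} {a : ℕ × (X ↪ V)} (ha : a ∈ l) :
    copyEdges E a.2 ⊆ listEdges E l := by
  induction l with
  | nil => simp at ha
  | cons b l ih =>
    rw [listEdges]
    rcases List.mem_cons.1 ha with rfl | ha
    · exact subset_union_left
    · exact (ih ha).trans subset_union_right

variable [Fintype X]

lemma subset_listVerts {l : List (ℕ × (X ↪ V))} {r : Finset V} (hr : r ∈ listEdges E l) :
    r ⊆ listVerts l := by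
  induction l with
  | nil => simp [listEdges] at hr
  | cons a l ih =>
    rw [listEdges, mem_union] at hr
    rw [listVerts]
    rcases hr with hr | hr
    · exact (subset_of_mem_copyEdges hr).trans subset_union_left
    · exact (ih hr).trans subset_union_right

lemma card_listVerts_le (l : List (ℕ × (X ↪ V))) :
    #(listVerts l) ≤ Fintype.card X * l.length := by
  induction l with
  | nil => simp [listVerts]
  | cons a l ih =>
    rw [listVerts, List.length_cons, mul_add, mul_one, add_comm]
    refine (card_union_le _ _).trans (add_le_add ?_ ih)
    rw [card_map, card_univ]

end

section

variable [Fintype X] [DecidableEq X]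

/-- The possible intersections of a new copy with the explored graph in a degenerate step, as pairs
of a vertex set and an edge set. They have more weight `m |S| - |Q|` than a single edge. -/
noncomputable def heavySubgraphs (ℓ : ℕ) (m : ℝ) (E : Finset (Finset X)) :
    Finset (Finset X × Finset (Finset X)) :=
  {J | J.2 ⊆ E ∧ m * ℓ - 1 < m * #J.1 - #J.2}

lemma exists_heavySubgraphs_gap (ℓ : ℕ) (m : ℝ) (E : Finset (Finset X)) :
    ∃ α : ℝ, 0 < α ∧ ∀ J ∈ heavySubgraphs ℓ m E, m * ℓ - 1 + α ≤ m * #J.1 - #J.2 := by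
  by_cases h : (heavySubgraphs ℓ m E).Nonempty
  · obtain ⟨J, hJ, hmin⟩ := exists_min_image _ (fun J => m * #J.1 - #J.2) h
    have hJ' := (mem_filter.1 hJ).2.2
    refine ⟨m * #J.1 - #J.2 - (m * ℓ - 1), by linarith, fun J' hJ' => ?_⟩
    have := hmin J' hJ'
    linarith
  · rw [not_nonempty_iff_eq_empty] at h
    exact ⟨1, one_pos, by simp [h]⟩

variable [DecidableEq V] [Fintype V] {ℓ : ℕ} {m : ℝ} {E : Finset (Finset X)}

open Classical in
/-- The total weight of the copies which share an edge with a given explored copy `ψ`. A regular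
step costs at most `|X| ^ ℓ |V| ^ (|X| - ℓ) q ^ (|E| - 1)` for each choice of the attachment edge. -/
lemma sum_copies_le (hE : IsBalancedFamily ℓ m E) {q y : ℝ} (hq : 0 ≤ q) (hy : 1 ≤ y)
    {VL : Finset V} {G : Finset (Finset V)} (hG : ∀ r ∈ G, r ⊆ VL) {ψ : X ↪ V}
    (hψ : copyEdges E ψ ⊆ G) :
    ∑ φ : X ↪ V with (copyEdges E φ ∩ copyEdges E ψ).Nonempty ∧ ¬ copyEdges E φ ⊆ G,
      q ^ #(copyEdges E φ \ G) * y ^ degenCount E VL G φ ≤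
    (#E * ((Fintype.card X : ℝ) ^ ℓ * (Fintype.card V : ℝ) ^ (Fintype.card X - ℓ))) *
        q ^ (#E - 1) +
      ∑ J ∈ heavySubgraphs ℓ m E, ((#VL : ℝ) ^ #J.1 *
        (Fintype.card V : ℝ) ^ (Fintype.card X - #J.1)) * (q ^ (#E - #J.2) * y) := by
  have hy0 : 0 ≤ y := by linarith
  set Sreg : (X ↪ V) → Finset X → ℝ := fun φ S =>
    if ∀ x ∈ S, φ x ∈ univ.map ψ then q ^ (#E - 1) else 0 with hSreg
  set Sdeg : (X ↪ V) → Finset X × Finset (Finset X) → ℝ := fun φ J =>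
    if ∀ x ∈ J.1, φ x ∈ VL then q ^ (#E - #J.2) * y else 0 with hSdeg
  have hreg0 : ∀ φ S, 0 ≤ Sreg φ S := fun φ S => by simp only [hSreg]; split_ifs <;> positivity
  have hdeg0 : ∀ φ J, 0 ≤ Sdeg φ J := fun φ J => by simp only [hSdeg]; split_ifs <;> positivity
  have hpt : ∀ φ : X ↪ V, (copyEdges E φ ∩ copyEdges E ψ).Nonempty → ¬ copyEdges E φ ⊆ G →
      q ^ #(copyEdges E φ \ G) * y ^ degenCount E VL G φ ≤
        ∑ S ∈ E, Sreg φ S + ∑ J ∈ heavySubgraphs ℓ m E, Sdeg φ J := by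
    intro φ hmeet hnew
    set S : Finset X := {x | φ x ∈ VL} with hS
    set Q : Finset (Finset X) := {a ∈ E | a.map φ ∈ G} with hQ
    have hQS : ∀ a ∈ Q, a ⊆ S := by
      intro a ha x hx
      exact mem_filter.2 ⟨mem_univ _, hG _ (mem_filter.1 ha).2 (mem_map_of_mem _ hx)⟩
    obtain ⟨e, he⟩ := hmeet
    obtain ⟨heφ, heψ⟩ := mem_inter.1 he
    obtain ⟨a, ha, rfl⟩ := mem_copyEdges.1 heφ
    have haQ : a ∈ Q := mem_filter.2 ⟨ha, hψ heψ⟩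
    have hinter : copyEdges E φ ∩ G = Q.image (Finset.map φ) := by
      ext r
      simp only [mem_inter, mem_copyEdges, mem_image, hQ, mem_filter]
      constructor
      · rintro ⟨⟨b, hb, rfl⟩, hr⟩; exact ⟨b, ⟨hb, hr⟩, rfl⟩
      · rintro ⟨b, ⟨hb, hr⟩, rfl⟩; exact ⟨⟨b, hb, rfl⟩, hr⟩
    have hcard : #(copyEdges E φ \ G) = #E - #Q := by
      have h1 := card_sdiff_add_card_inter (copyEdges E φ) G
      rw [hinter, card_image_of_injective _ (Finset.map_injective φ), card_copyEdges] at h1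
      omega
    have hVS : univ.map φ ∩ VL = S.map φ := by
      ext v
      simp only [mem_inter, mem_map, mem_univ, true_and, hS, mem_filter]
      constructor
      · rintro ⟨⟨x, rfl⟩, hv⟩; exact ⟨x, hv, rfl⟩
      · rintro ⟨x, hv, rfl⟩; exact ⟨⟨x, rfl⟩, hv⟩
    rcases hE.trichotomy (S := S) (Q := Q) (filter_subset _ _) ⟨a, haQ⟩ hQS with h | ⟨-, h⟩ | h
    · have haS : a = S := mem_singleton.1 (h ▸ haQ)
      have hreg : ∃ h, IsRegularAt E VL G φ h :=
        ⟨S.map φ, by rw [hinter, h, image_singleton], hVS⟩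
      rw [degenCount, if_pos hreg, pow_zero, mul_one, hcard, h, card_singleton]
      refine le_add_of_le_of_nonneg ?_ (sum_nonneg fun J _ => hdeg0 φ J)
      have h1 : Sreg φ a = q ^ (#E - 1) := by
        simp only [hSreg]
        rw [if_pos]
        intro x hx
        exact subset_of_mem_copyEdges heψ (mem_map_of_mem _ hx)
      rw [← h1]
      exact single_le_sum (f := fun S => Sreg φ S) (fun S _ => hreg0 φ S) ha
    · refine absurd (fun r hr => ?_) hnew
      obtain ⟨b, hb, rfl⟩ := mem_copyEdges.1 hr
      rw [← h] at hb
      exact (mem_filter.1 hb).2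
    · have hJ : (S, Q) ∈ heavySubgraphs ℓ m E :=
        mem_filter.2 ⟨mem_univ _, filter_subset _ _, h⟩
      refine le_add_of_nonneg_of_le (sum_nonneg fun S _ => hreg0 φ S) ?_
      have h1 : Sdeg φ (S, Q) = q ^ (#E - #Q) * y := by
        simp only [hSdeg]
        rw [if_pos]
        intro x hx
        exact (mem_filter.1 hx).2
      rw [hcard]
      calc q ^ (#E - #Q) * y ^ degenCount E VL G φ
          ≤ q ^ (#E - #Q) * y := by
            refine mul_le_mul_of_nonneg_left ?_ (by positivity)
            rw [degenCount]
            split_ifs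
            · simpa using hy
            · simp
        _ = Sdeg φ (S, Q) := h1.symm
        _ ≤ _ := single_le_sum (f := fun J => Sdeg φ J) (fun J _ => hdeg0 φ J) hJ
  calc
    _ ≤ ∑ φ : X ↪ V, (∑ S ∈ E, Sreg φ S + ∑ J ∈ heavySubgraphs ℓ m E, Sdeg φ J) := by
        rw [sum_filter]
        refine sum_le_sum fun φ _ => ?_
        by_cases h : (copyEdges E φ ∩ copyEdges E ψ).Nonempty ∧ ¬ copyEdges E φ ⊆ G
        · rw [if_pos h]
          exact hpt φ h.1 h.2
        · rw [if_neg h]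
          exact add_nonneg (sum_nonneg fun S _ => hreg0 φ S)
            (sum_nonneg fun J _ => hdeg0 φ J)
    _ = ∑ S ∈ E, ∑ φ : X ↪ V, Sreg φ S +
          ∑ J ∈ heavySubgraphs ℓ m E, ∑ φ : X ↪ V, Sdeg φ J := by
        rw [sum_add_distrib, sum_comm, sum_comm (s := (univ : Finset (X ↪ V))) (t := heavySubgraphs ℓ m E)]
    _ ≤ _ := by
        refine add_le_add ?_ (sum_le_sum fun J _ => ?_)
        · rw [mul_assoc, ← nsmul_eq_mul]
          refine sum_le_card_nsmul _ _ _ fun S hS => ?_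
          simp only [hSreg]
          rw [← sum_filter, sum_const, nsmul_eq_mul]
          refine mul_le_mul_of_nonneg_right ?_ (by positivity)
          have := card_embedding_filter_le S (univ.map ψ)
          rw [card_map, card_univ, hE.card_edge S hS] at this
          exact_mod_cast this
        · simp only [hSdeg]
          rw [← sum_filter, sum_const, nsmul_eq_mul]
          refine mul_le_mul_of_nonneg_right ?_ (by positivity)
          exact_mod_cast card_embedding_filter_le J.1 VL

end

variable [Fintype X] [Fintype V] [DecidableEq V] {E : Finset (Finset X)}

/-- The weight of a list of copies. The edges count for their probability, and each degenerate
step is rewarded by a factor `y`, which is to be a small power of the number of vertices. The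
factor `2 ^ (-pointer)` makes the sum over all choices of the pointers converge. -/
noncomputable def listWeight (E : Finset (Finset X)) (q y : ℝ) (l : List (ℕ × (X ↪ V))) : ℝ :=
  q ^ #(listEdges E l) * y ^ listDegen E l * (1 / 2) ^ listPtr l

/-- One step multiplies the total weight by at most `2 r` if `r` bounds the total weight of the
copies attached to a fixed one. -/
lemma sum_listNext_le {q y r : ℝ} (hq : 0 ≤ q) (hy : 1 ≤ y)
    {l : List (ℕ × (X ↪ V))} (hl : l ≠ [])
    (hr : ∀ ψ : X ↪ V, copyEdges E ψ ⊆ listEdges E l →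
      (open Classical in
      ∑ φ : X ↪ V with (copyEdges E φ ∩ copyEdges E ψ).Nonempty ∧
        ¬ copyEdges E φ ⊆ listEdges E l, q ^ #(copyEdges E φ \ listEdges E l) *
        y ^ degenCount E (listVerts l) (listEdges E l) φ) ≤ r)
    (hr0 : 0 ≤ r) :
    ∑ a ∈ listNext E l, listWeight E q y (a :: l) ≤ 2 * r * listWeight E q y l := by
  classical
  set g : (X ↪ V) → ℝ := fun φ => q ^ #(copyEdges E φ \ listEdges E l) *
        y ^ degenCount E (listVerts l) (listEdges E l) φ with hg
  have hg0 : ∀ φ, 0 ≤ g φ := fun φ => by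
    have : 0 ≤ y := by linarith
    positivity
  set w0 : ℝ := q ^ #(listEdges E l) * y ^ listDegen E l with hw0
  have hw00 : 0 ≤ w0 := by
    have : 0 ≤ y := by linarith
    positivity
  have hw : ∀ a : ℕ × (X ↪ V), listWeight E q y (a :: l) = w0 * ((1 / 2) ^ a.1 * g a.2) := by
    intro a
    have hc : #(listEdges E (a :: l)) = #(listEdges E l) + #(copyEdges E a.2 \ listEdges E l) := by
      rw [listEdges, union_comm, ← union_sdiff_self_eq_union, card_union_of_disjoint
        disjoint_sdiff]
    rw [listWeight, hc, listDegen, listPtr, hw0, pow_add, pow_add]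
    simp only [hg]
    ring
  simp_rw [hw]
  rw [← mul_sum]
  obtain ⟨a, l', rfl⟩ := List.exists_cons_of_ne_nil hl
  have hmain : ∑ b ∈ listNext E (a :: l'), ((1 / 2 : ℝ) ^ b.1 * g b.2) ≤
      ∑ j ∈ Ico a.1 (l'.length + 1), (1 / 2 : ℝ) ^ j * r := by
    rw [listNext, sum_filter, sum_product]
    have hIco : Ico a.1 (l'.length + 1) = {j ∈ range (l'.length + 1) | a.1 ≤ j} := by
      ext j; simp [and_comm]
    rw [hIco, sum_filter]
    refine sum_le_sum fun j _ => ?_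
    by_cases hj : a.1 ≤ j
    · rw [if_pos hj]
      rcases hopt : (a :: l').reverse[j]? with _ | c
      · rw [sum_eq_zero]
        · positivity
        · intro φ _
          rw [if_neg]
          rintro ⟨-, ⟨c, hc, -⟩, -⟩
          simp only [hopt] at hc
          exact Option.some_ne_none c hc.symm
      · have hcl : copyEdges E c.2 ⊆ listEdges E (a :: l') :=
          copyEdges_subset_listEdges (List.mem_reverse.1 (List.mem_of_getElem? hopt))
        refine le_trans ?_ (mul_le_mul_of_nonneg_left (hr c.2 hcl) (by positivity))
        rw [mul_sum, sum_filter]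
        refine sum_le_sum fun φ _ => le_of_eq ?_
        refine if_congr ?_ rfl rfl
        constructor
        · rintro ⟨-, ⟨c', hc', h1⟩, h2⟩
          simp only [hopt, Option.some.injEq] at hc'
          exact ⟨hc' ▸ h1, h2⟩
        · rintro ⟨h1, h2⟩
          exact ⟨hj, ⟨c, hopt, h1⟩, h2⟩
    · rw [if_neg hj, sum_eq_zero]
      intro φ _
      rw [if_neg fun h => hj h.1]
  have hgeom : ∑ j ∈ Ico a.1 (l'.length + 1), (1 / 2 : ℝ) ^ j ≤ (1 / 2) ^ a.1 / (1 - 1 / 2) :=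
    geom_sum_Ico_le_of_lt_one (by norm_num) (by norm_num)
  rw [← sum_mul] at hmain
  calc w0 * ∑ b ∈ listNext E (a :: l'), ((1 / 2 : ℝ) ^ b.1 * g b.2)
      ≤ w0 * ((1 / 2) ^ a.1 / (1 - 1 / 2) * r) :=
        mul_le_mul_of_nonneg_left (hmain.trans (mul_le_mul_of_nonneg_right hgeom hr0)) hw00
    _ = 2 * r * listWeight E q y (a :: l') := by
        rw [listWeight, listPtr, ← hw0]; ring

end

/-! ### Union bounds for the random family of edges -/

section

open MeasureTheory ProbabilityTheory in
lemma setBernoulli_real_superset_le {ι : Type*} [Countable ι] (u : Set ι) (p : unitInterval)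
    (A : Finset ι) :
    (setBernoulli u p).real {S : Set ι | ∀ a ∈ A, a ∈ S} ≤ (p : ℝ) ^ #A := by
  classical
  have h1 : (setBernoulli u p) {S : Set ι | ∀ a ∈ A, a ∈ S} ≤
      (unitInterval.toNNReal p : ENNReal) ^ #A := by
    have h2 : ((fun p : ι → Prop => {i | p i}) ⁻¹' {S : Set ι | ∀ a ∈ A, a ∈ S}) =
        cylinder (α := fun _ : ι => Prop) A {fun _ => True} := by
      ext f
      simp [funext_iff]
    rw [setBernoulli_apply', h2, Measure.infinitePi_cylinder _ (.of_discrete)]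
    rw [← Set.univ_pi_singleton, Measure.pi_pi]
    rw [← prod_const, ← Finset.prod_coe_sort A]
    refine prod_le_prod' fun i _ => ?_
    by_cases hi : (i : ι) ∈ u <;> simp [hi]
  have h3 := ENNReal.toReal_mono (by simp) h1
  simpa [measureReal_def] using h3

open MeasureTheory ProbabilityTheory in
lemma setBernoulli_real_exists_le {ι κ : Type*} [Countable ι] (u : Set ι) (p : unitInterval)
    (I : Finset κ) (A : κ → Finset ι) :
    (setBernoulli u p).real {S : Set ι | ∃ k ∈ I, ∀ a ∈ A k, a ∈ S} ≤
      ∑ k ∈ I, (p : ℝ) ^ #(A k) := by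
  have h : {S : Set ι | ∃ k ∈ I, ∀ a ∈ A k, a ∈ S} =
      ⋃ k ∈ I, {S : Set ι | ∀ a ∈ A k, a ∈ S} := by
    ext S; simp
  rw [h]
  exact (measureReal_biUnion_finset_le I _).trans
    (sum_le_sum fun k _ => setBernoulli_real_superset_le u p (A k))

/-- The event that some family `A k` of finite sets, `k ∈ I`, is contained in the random family of
edges. -/
lemma setBernoulli_real_exists_finset_le {V κ : Type*} [Finite V] (u : Set (Set V))
    (p : unitInterval) (I : Finset κ) (A : κ → Finset (Finset V)) :
    (ProbabilityTheory.setBernoulli u p).real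
      {S : Set (Set V) | ∃ k ∈ I, ∀ a ∈ A k, (a : Set V) ∈ S} ≤ ∑ k ∈ I, (p : ℝ) ^ #(A k) := by
  have h := setBernoulli_real_exists_le u p I
    (fun k => (A k).map ⟨fun a : Finset V => (a : Set V), Finset.coe_injective⟩)
  simpa using h

/-! ### Explorations are short -/

variable {X V : Type*} [Fintype X] [DecidableEq V] {E : Finset (Finset X)}

section

variable [Fintype V]

lemma listPtr_le {t : ℕ} {l : List (ℕ × (X ↪ V))} (hl : l ∈ chains (listNext E) t) :
    listPtr l ≤ t := by
  cases t with
  | zero => rw [chains, mem_singleton] at hl; simp [hl, listPtr]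
  | succ t =>
    simp only [chains, mem_biUnion, mem_image] at hl
    obtain ⟨l', hl', a, ha, rfl⟩ := hl
    have hlen := length_of_mem_chains hl'
    cases l' with
    | nil =>
      simp only [listNext, mem_product, mem_singleton] at ha
      simp [listPtr, ha.1]
    | cons b l' =>
      simp only [listNext, mem_filter, mem_product, mem_range] at ha
      rw [List.length_cons] at hlen
      simp only [listPtr]
      omega

/-- If one step has total weight at most `1 / 8`, the chains of length `t` have exponentially small
total probability, even after each degenerate step has been rewarded by the factor `y`. -/
lemma sum_chains_pow_le {q y : ℝ} (hq : 0 ≤ q) (hq1 : q ≤ 1) (hy : 1 ≤ y) {T : ℕ}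
    (hr : ∀ l : List (ℕ × (X ↪ V)), l ≠ [] → l.length < T → ∀ ψ : X ↪ V,
      copyEdges E ψ ⊆ listEdges E l →
      (open Classical in
      ∑ φ : X ↪ V with (copyEdges E φ ∩ copyEdges E ψ).Nonempty ∧
        ¬ copyEdges E φ ⊆ listEdges E l, q ^ #(copyEdges E φ \ listEdges E l) *
        y ^ degenCount E (listVerts l) (listEdges E l) φ) ≤ 1 / 8) {t : ℕ} (ht : t < T) :
    ∑ l ∈ chains (listNext E (V := V)) (t + 1), q ^ #(listEdges E l) * y ^ listDegen E l ≤
      4 * ((Fintype.card V : ℝ) ^ Fintype.card X * y) * (1 / 2) ^ (t + 1) := by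
  have hy0 : 0 ≤ y := by linarith
  have h0 : ∑ a ∈ listNext E ([] : List (ℕ × (X ↪ V))), listWeight E q y [a] ≤
      (Fintype.card V : ℝ) ^ Fintype.card X * y := by
    classical
    have hcard : (#(listNext (V := V) E []) : ℝ) ≤ (Fintype.card V : ℝ) ^ Fintype.card X := by
      rw [listNext, card_product, card_singleton, one_mul, card_univ]
      have := Fintype.card_le_of_injective (fun φ : X ↪ V => (φ : X → V))
        DFunLike.coe_injective
      rw [Fintype.card_fun] at this
      exact_mod_cast this
    refine (sum_le_card_nsmul _ _ y fun a ha => ?_).trans ?_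
    · have ha0 : a.1 = 0 := by
        simp only [listNext, mem_product, mem_singleton] at ha
        exact ha.1
      rw [listWeight, listPtr, ha0, pow_zero, mul_one]
      have h1 : q ^ #(listEdges E [a]) ≤ 1 := pow_le_one₀ hq hq1
      have h2 : y ^ listDegen E [a] ≤ y := by
        rw [listDegen, listDegen, degenCount]
        split_ifs
        · simpa using hy
        · simp
      calc _ ≤ 1 * y := mul_le_mul h1 h2 (by positivity) zero_le_one
        _ = y := one_mul y
    · rw [nsmul_eq_mul]
      exact mul_le_mul_of_nonneg_right hcard hy0
  have hmain := sum_chains_le (K := 1 / 4) (by norm_num) h0 (T := T)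
    (fun l hl hlT => (sum_listNext_le hq hy hl (hr l hl hlT) (by norm_num)).trans
      (by norm_num)) ht
  calc ∑ l ∈ chains (listNext E (V := V)) (t + 1), q ^ #(listEdges E l) * y ^ listDegen E l
      ≤ ∑ l ∈ chains (listNext E (V := V)) (t + 1), 2 ^ (t + 1) * listWeight E q y l := by
        refine sum_le_sum fun l hl => ?_
        have h1 : (1 : ℝ) ≤ 2 ^ (t + 1) * (1 / 2) ^ listPtr l := by
          have h2 : ((1 : ℝ) / 2) ^ (t + 1) ≤ (1 / 2) ^ listPtr l :=
            pow_le_pow_of_le_one (by norm_num) (by norm_num) (listPtr_le hl)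
          calc (1 : ℝ) = 2 ^ (t + 1) * (1 / 2) ^ (t + 1) := by
                rw [← mul_pow]; norm_num
            _ ≤ _ := mul_le_mul_of_nonneg_left h2 (by positivity)
        rw [listWeight]
        calc q ^ #(listEdges E l) * y ^ listDegen E l
            = (q ^ #(listEdges E l) * y ^ listDegen E l) * 1 := (mul_one _).symm
          _ ≤ (q ^ #(listEdges E l) * y ^ listDegen E l) * (2 ^ (t + 1) * (1 / 2) ^ listPtr l) :=
              mul_le_mul_of_nonneg_left h1 (by positivity)
          _ = _ := by ring
    _ = 2 ^ (t + 1) * ∑ l ∈ chains (listNext E (V := V)) (t + 1), listWeight E q y l := by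
        rw [mul_sum]
    _ ≤ 2 ^ (t + 1) * ((Fintype.card V : ℝ) ^ Fintype.card X * y * (1 / 4) ^ t) :=
        mul_le_mul_of_nonneg_left hmain (by positivity)
    _ = 4 * ((Fintype.card V : ℝ) ^ Fintype.card X * y) * (1 / 2) ^ (t + 1) := by
        have h1 : (1 / 2 : ℝ) ^ (t + 1) = 2 ^ (t + 1) * (1 / 4) ^ (t + 1) := by
          rw [← mul_pow]; norm_num
        rw [h1, pow_succ (1 / 4 : ℝ)]
        ring

end

variable [DecidableEq X]

/-- A block with many vertices contains a long chain of copies, or a chain with many degenerate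
steps. -/
lemma IsBlockFamily.exists_chain [Fintype V] {ℓ γ : ℕ} {m : ℝ} {B : Finset (Finset V)}
    (hE : IsBalancedFamily ℓ m E)
    (hcase : (γ = ℓ - 1 ∧ 3 ≤ #E) ∨ 4 ≤ #E)
    (hγ : ∀ a ∈ E, ∀ b ∈ E, a ≠ b → #(a ∩ b) ≤ γ)
    (hcov : ∀ (ψ : X ↪ V), ∀ e ∈ copyEdges E ψ,
      γ < #(e ∩ ((copyEdges E ψ).erase e).biUnion id))
    (hB : IsBlockFamily ℓ γ E B) {D T : ℕ} (hT : 1 ≤ T)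
    (hlarge : Fintype.card X * ((2 * Fintype.card X + 3) * D) < #(B.biUnion id)) :
    ∃ t, 1 ≤ t ∧ t ≤ T ∧ ∃ l ∈ chains (listNext E (V := V)) t, listEdges E l ⊆ B ∧
      (t = T ∨ D + 1 ≤ listDegen E l) := by
  have h3 : 3 ≤ #E := by omega
  have hBne : B.Nonempty := by
    by_contra h
    rw [not_nonempty_iff_eq_empty] at h
    simp [h] at hlarge
  rcases exists_exploration (card_pos.1 (by omega)) hB hBne hT with
    ⟨φ, ptr, hX⟩ | ⟨N, φ, ptr, hN, hX, hcomp⟩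
  · exact ⟨T, hT, le_rfl, seqList φ ptr T, hX.seqList_mem_chains le_rfl,
      (listEdges_seqList (E := E) (φ := φ) (ptr := ptr) T).trans_subset hX.edgesBefore_subset,
      Or.inl rfl⟩
  · have hN1 : 1 ≤ N := by
      by_contra h
      have hN0 : N = 0 := by omega
      rw [← hcomp, hN0] at hBne
      simp [edgesBefore] at hBne
    refine ⟨N, hN1, hN.le, seqList φ ptr N, hX.seqList_mem_chains le_rfl,
      (listEdges_seqList (E := E) (φ := φ) (ptr := ptr) N).trans_subset hX.edgesBefore_subset,
      Or.inr ?_⟩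
    have hlen := exploration_length_le hE (by omega) hcase hγ hcov hB hX hcomp
    have hdeg := listDegen_seqList (E := E) (φ := φ) (ptr := ptr) hN1
    have hverts : #(B.biUnion id) ≤ Fintype.card X * N := by
      have h1 : B.biUnion id ⊆ vertsBefore φ N :=
        biUnion_subset.2 fun e he => subset_vertsBefore (hcomp.symm ▸ he)
      refine (card_le_card h1).trans ?_
      have := card_listVerts_le (seqList φ ptr N)
      rwa [listVerts_seqList, length_seqList] at this
    by_contra! hlt
    have h4 : N ≤ (2 * Fintype.card X + 3) * D := by
      refine hlen.trans ?_
      have h5 : (2 * Fintype.card X + 3) * listDegen E (seqList φ ptr N) ≤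
          (2 * Fintype.card X + 3) * D := Nat.mul_le_mul_left _ (by omega)
      rw [hdeg, mul_add] at h5
      omega
    exact absurd (hverts.trans (Nat.mul_le_mul_left _ h4)) (by omega)

/-- The probability that there is a large block. -/
lemma prob_large_block_le [Fintype V] {ℓ γ : ℕ} {m : ℝ}
    (hE : IsBalancedFamily ℓ m E)
    (hcase : (γ = ℓ - 1 ∧ 3 ≤ #E) ∨ 4 ≤ #E)
    (hγ : ∀ a ∈ E, ∀ b ∈ E, a ≠ b → #(a ∩ b) ≤ γ)
    (hcov : ∀ (ψ : X ↪ V), ∀ e ∈ copyEdges E ψ,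
      γ < #(e ∩ ((copyEdges E ψ).erase e).biUnion id))
    {q y : ℝ} (hq : 0 ≤ q) (hq1 : q ≤ 1) (hy : 1 ≤ y) {D T : ℕ} (hT : 1 ≤ T)
    (hr : ∀ l : List (ℕ × (X ↪ V)), l ≠ [] → l.length < T → ∀ ψ : X ↪ V,
      copyEdges E ψ ⊆ listEdges E l →
      (open Classical in
      ∑ φ : X ↪ V with (copyEdges E φ ∩ copyEdges E ψ).Nonempty ∧
        ¬ copyEdges E φ ⊆ listEdges E l, q ^ #(copyEdges E φ \ listEdges E l) *
        y ^ degenCount E (listVerts l) (listEdges E l) φ) ≤ 1 / 8)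
    (u : Set (Set V)) (p : unitInterval) (hp : (p : ℝ) ≤ q) :
    (ProbabilityTheory.setBernoulli u p).real {S : Set (Set V) | ∃ B : Finset (Finset V),
      IsBlockFamily ℓ γ E B ∧ (∀ e ∈ B, (e : Set V) ∈ S) ∧
      Fintype.card X * ((2 * Fintype.card X + 3) * D) < #(B.biUnion id)} ≤
    4 * ((Fintype.card V : ℝ) ^ Fintype.card X * y) * (1 / 2) ^ T +
      T * (4 * ((Fintype.card V : ℝ) ^ Fintype.card X * y) / y ^ (D + 1)) := by
  classical
  have hy0 : 0 < y := by linarith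
  have hp0 : 0 ≤ (p : ℝ) := p.2.1
  set W : ℝ := 4 * ((Fintype.card V : ℝ) ^ Fintype.card X * y) with hW
  have hW0 : 0 ≤ W := by positivity
  have hsum : ∀ t < T, ∑ l ∈ chains (listNext E (V := V)) (t + 1),
      q ^ #(listEdges E l) * y ^ listDegen E l ≤ W * (1 / 2) ^ (t + 1) := fun t ht =>
    sum_chains_pow_le hq hq1 hy hr ht
  set I : Finset (List (ℕ × (X ↪ V))) := chains (listNext E) T ∪
    (range T).biUnion fun t => {l ∈ chains (listNext E) (t + 1) | D + 1 ≤ listDegen E l} with hI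
  calc _ ≤ (ProbabilityTheory.setBernoulli u p).real
        {S : Set (Set V) | ∃ l ∈ I, ∀ a ∈ listEdges E l, (a : Set V) ∈ S} := by
        refine MeasureTheory.measureReal_mono ?_ (MeasureTheory.measure_ne_top _ _)
        rintro S ⟨B, hB, hBS, hlarge⟩
        obtain ⟨t, ht1, htT, l, hl, hlB, hor⟩ := hB.exists_chain hE hcase hγ hcov hT hlarge
        refine ⟨l, ?_, fun a ha => hBS a (hlB ha)⟩
        rw [hI, mem_union]
        rcases hor with rfl | hd
        · exact Or.inl hl
        · obtain ⟨t, rfl⟩ : ∃ s, t = s + 1 := ⟨t - 1, by omega⟩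
          exact Or.inr (mem_biUnion.2 ⟨t, mem_range.2 (by omega), mem_filter.2 ⟨hl, hd⟩⟩)
    _ ≤ ∑ l ∈ I, (p : ℝ) ^ #(listEdges E l) := setBernoulli_real_exists_finset_le u p I _
    _ ≤ ∑ l ∈ I, q ^ #(listEdges E l) :=
        sum_le_sum fun l _ => pow_le_pow_left₀ hp0 hp _
    _ ≤ ∑ l ∈ chains (listNext E (V := V)) T, q ^ #(listEdges E l) +
          ∑ t ∈ range T, ∑ l ∈ chains (listNext E (V := V)) (t + 1) with D + 1 ≤ listDegen E l,
            q ^ #(listEdges E l) := by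
        have h1 : ∀ s t : Finset (List (ℕ × (X ↪ V))),
            ∑ l ∈ s ∪ t, q ^ #(listEdges E l) ≤
              ∑ l ∈ s, q ^ #(listEdges E l) + ∑ l ∈ t, q ^ #(listEdges E l) := by
          intro s t
          rw [← sum_union_inter]
          exact le_add_of_nonneg_right (sum_nonneg fun l _ => by positivity)
        refine (h1 _ _).trans (add_le_add le_rfl (le_of_eq ?_))
        refine sum_biUnion fun t _ t' _ hne => disjoint_left.2 fun l hl hl' => hne ?_
        have h2 := length_of_mem_chains (mem_filter.1 hl).1
        have h3 := length_of_mem_chains (mem_filter.1 hl').1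
        omega
    _ ≤ W * (1 / 2) ^ T + T * (W / y ^ (D + 1)) := by
        refine add_le_add ?_ ?_
        · obtain ⟨t, rfl⟩ : ∃ s, T = s + 1 := ⟨T - 1, by omega⟩
          refine le_trans (sum_le_sum fun l _ => ?_) (hsum t (by omega))
          exact le_mul_of_one_le_right (by positivity) (one_le_pow₀ hy)
        · have h1 : ∀ t ∈ range T,
              ∑ l ∈ chains (listNext E (V := V)) (t + 1) with D + 1 ≤ listDegen E l,
                q ^ #(listEdges E l) ≤ W / y ^ (D + 1) := by
            intro t ht
            rw [le_div_iff₀ (by positivity), sum_mul]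
            calc _ ≤ ∑ l ∈ chains (listNext E (V := V)) (t + 1) with D + 1 ≤ listDegen E l,
                    q ^ #(listEdges E l) * y ^ listDegen E l := by
                  refine sum_le_sum fun l hl => mul_le_mul_of_nonneg_left ?_ (by positivity)
                  exact pow_le_pow_right₀ hy (mem_filter.1 hl).2
              _ ≤ ∑ l ∈ chains (listNext E (V := V)) (t + 1),
                    q ^ #(listEdges E l) * y ^ listDegen E l :=
                  sum_le_sum_of_subset_of_nonneg (filter_subset _ _)
                    fun l _ _ => by positivity
              _ ≤ W * (1 / 2) ^ (t + 1) := hsum t (mem_range.1 ht)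
              _ ≤ W := mul_le_of_le_one_right hW0 (pow_le_one₀ (by norm_num) (by norm_num))
          have := sum_le_card_nsmul _ _ _ h1
          rwa [card_range, nsmul_eq_mul] at this

end

/-! ### Asymptotics of the weights -/

section

section

variable {X : Type*} [Fintype X] [DecidableEq X] {E : Finset (Finset X)} {ℓ : ℕ} {m : ℝ}

lemma pow_mul_threshold_pow {n : ℕ} (hn : 1 ≤ n) (c m : ℝ) (s k : ℕ) :
    (n : ℝ) ^ s * (c * (n : ℝ) ^ (-(1 / m))) ^ k = c ^ k * (n : ℝ) ^ ((s : ℝ) - k / m) := by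
  have hn0 : (0 : ℝ) < n := by exact_mod_cast hn
  rw [mul_pow, ← Real.rpow_natCast (n : ℝ) s, ← Real.rpow_natCast ((n : ℝ) ^ (-(1 / m))) k,
    ← Real.rpow_mul hn0.le, mul_left_comm, ← Real.rpow_add hn0]
  congr 2
  ring

/-- At the threshold, the copies attached to a fixed copy have total weight at most `1 / 8`. -/
lemma sum_copies_threshold_le (hE : IsBalancedFamily ℓ m E) (h2 : 2 ≤ #E) {n : ℕ} (hn : 1 ≤ n)
    {c α : ℝ} (hc : 0 < c) (hc1 : c ≤ 1)
    (hcE : #E * (Fintype.card X : ℝ) ^ ℓ * c ≤ 1 / 16) (hα : 0 < α)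
    (hgap : ∀ J ∈ heavySubgraphs ℓ m E, m * ℓ - 1 + α * m ≤ m * #J.1 - #J.2) {T : ℕ} (hT : 1 ≤ T)
    (hbig : #(heavySubgraphs ℓ m E) * ((Fintype.card X * T : ℝ) ^ Fintype.card X *
      (n : ℝ) ^ (-(α / 2))) ≤ 1 / 16)
    {l : List (ℕ × (X ↪ Fin n))} (hl : l.length < T) {ψ : X ↪ Fin n}
    (hψ : copyEdges E ψ ⊆ listEdges E l) :
    (open Classical in
      ∑ φ : X ↪ Fin n with (copyEdges E φ ∩ copyEdges E ψ).Nonempty ∧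
        ¬ copyEdges E φ ⊆ listEdges E l,
        (c * (n : ℝ) ^ (-(1 / m))) ^ #(copyEdges E φ \ listEdges E l) *
        ((n : ℝ) ^ (α / 2)) ^ degenCount E (listVerts l) (listEdges E l) φ) ≤ 1 / 8 := by
  have hn0 : (0 : ℝ) < n := by exact_mod_cast hn
  have hn1 : (1 : ℝ) ≤ n := by exact_mod_cast hn
  have hm := hE.pos
  have hw := hE.whole
  obtain ⟨a, ha⟩ : E.Nonempty := card_pos.1 (by omega)
  have hℓ : ℓ ≤ Fintype.card X := hE.card_edge a ha ▸ card_le_univ a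
  have hv : 1 ≤ Fintype.card X := by
    by_contra h
    have h0 : Fintype.card X = 0 := by omega
    have hℓ0 : ℓ = 0 := by omega
    rw [h0, hℓ0] at hw
    have : (2 : ℝ) ≤ #E := by exact_mod_cast h2
    simp at hw
    linarith
  refine (sum_copies_le hE (by positivity) (Real.one_le_rpow hn1 (by positivity))
    (fun r hr => subset_listVerts hr) hψ).trans ?_
  rw [Fintype.card_fin]
  have h1 : (#E * ((Fintype.card X : ℝ) ^ ℓ * (n : ℝ) ^ (Fintype.card X - ℓ))) *
      (c * (n : ℝ) ^ (-(1 / m))) ^ (#E - 1) ≤ 1 / 16 := by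
    have h3 : (n : ℝ) ^ (Fintype.card X - ℓ) * (c * (n : ℝ) ^ (-(1 / m))) ^ (#E - 1) ≤ c := by
      rw [pow_mul_threshold_pow hn]
      have h4 : ((Fintype.card X - ℓ : ℕ) : ℝ) - ((#E - 1 : ℕ) : ℝ) / m = 0 := by
        rw [Nat.cast_sub hℓ, Nat.cast_sub (by omega)]
        field_simp
        push_cast
        linarith
      rw [h4, Real.rpow_zero, mul_one]
      exact pow_le_of_le_one hc.le hc1 (by omega)
    calc _ = #E * (Fintype.card X : ℝ) ^ ℓ *
          ((n : ℝ) ^ (Fintype.card X - ℓ) * (c * (n : ℝ) ^ (-(1 / m))) ^ (#E - 1)) := by ring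
      _ ≤ #E * (Fintype.card X : ℝ) ^ ℓ * c := mul_le_mul_of_nonneg_left h3 (by positivity)
      _ ≤ _ := hcE
  have h3 : ∀ J ∈ heavySubgraphs ℓ m E, ((#(listVerts l) : ℝ) ^ #J.1 *
        (n : ℝ) ^ (Fintype.card X - #J.1)) *
        ((c * (n : ℝ) ^ (-(1 / m))) ^ (#E - #J.2) * (n : ℝ) ^ (α / 2)) ≤
      (Fintype.card X * T : ℝ) ^ Fintype.card X * (n : ℝ) ^ (-(α / 2)) := by
    intro J hJ
    have hJE : #J.2 ≤ #E := card_le_card (mem_filter.1 hJ).2.1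
    have hJX : #J.1 ≤ Fintype.card X := card_le_univ _
    have hg := hgap J hJ
    have hT1 : (1 : ℝ) ≤ Fintype.card X * T := by exact_mod_cast Nat.mul_pos hv hT
    have h4 : (#(listVerts l) : ℝ) ^ #J.1 ≤ (Fintype.card X * T : ℝ) ^ Fintype.card X := by
      have h5 : (#(listVerts l) : ℝ) ≤ Fintype.card X * T := by
        exact_mod_cast (card_listVerts_le l).trans (Nat.mul_le_mul_left _ hl.le)
      exact (pow_le_pow_left₀ (by positivity) h5 _).trans (pow_le_pow_right₀ hT1 hJX)
    have h6 : (n : ℝ) ^ (Fintype.card X - #J.1) *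
        (c * (n : ℝ) ^ (-(1 / m))) ^ (#E - #J.2) ≤ (n : ℝ) ^ (-α) := by
      rw [pow_mul_threshold_pow hn]
      refine (mul_le_of_le_one_left (by positivity) (pow_le_one₀ hc.le hc1)).trans ?_
      refine Real.rpow_le_rpow_of_exponent_le hn1 ?_
      rw [Nat.cast_sub hJX, Nat.cast_sub hJE, sub_le_iff_le_add, ← sub_le_iff_le_add', le_div_iff₀ hm]
      nlinarith
    calc _ = (#(listVerts l) : ℝ) ^ #J.1 * (((n : ℝ) ^ (Fintype.card X - #J.1) *
          (c * (n : ℝ) ^ (-(1 / m))) ^ (#E - #J.2)) * (n : ℝ) ^ (α / 2)) := by ring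
      _ ≤ (Fintype.card X * T : ℝ) ^ Fintype.card X * ((n : ℝ) ^ (-α) * (n : ℝ) ^ (α / 2)) := by
          refine mul_le_mul h4 (mul_le_mul_of_nonneg_right h6 (by positivity)) (by positivity)
            (by positivity)
      _ = _ := by
          rw [← Real.rpow_add hn0]
          congr 2
          ring
  have h4 := sum_le_card_nsmul _ _ _ h3
  rw [nsmul_eq_mul] at h4
  linarith

end

/-- The length at which explorations of a graph on `n` vertices are cut off. It is logarithmic in `n`,
but `2 ^ stepBound v n` exceeds the number of choices for the first copies. -/
def stepBound (v n : ℕ) : ℕ := (v + 2) * (Nat.log 2 n + 1) + 1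

lemma exists_stepBound_le (v : ℕ) {ε : ℝ} (hε : 0 < ε) :
    ∃ C : ℝ, 0 < C ∧ ∀ n : ℕ, 1 ≤ n → (stepBound v n : ℝ) ≤ C * (n : ℝ) ^ ε := by
  have hlog2 : 0 < Real.log 2 := Real.log_pos (by norm_num)
  refine ⟨(v + 2) * (1 / (ε * Real.log 2) + 1) + 1, by positivity, fun n hn => ?_⟩
  have hn1 : (1 : ℝ) ≤ n := by exact_mod_cast hn
  have h1 : (1 : ℝ) ≤ (n : ℝ) ^ ε := Real.one_le_rpow hn1 hε.le
  have h2 : (Nat.log 2 n : ℝ) ≤ 1 / (ε * Real.log 2) * (n : ℝ) ^ ε := by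
    have h3 := Real.natLog_le_logb n 2
    have h4 := Real.log_natCast_le_rpow_div n hε
    rw [Real.logb, le_div_iff₀ (by exact_mod_cast hlog2)] at h3
    push_cast at h3
    rw [div_mul_eq_mul_div, one_mul, le_div_iff₀ (by positivity)]
    rw [le_div_iff₀ hε] at h4
    nlinarith
  have h5 : ((v : ℝ) + 2) * (Nat.log 2 n + 1) ≤
      (v + 2) * ((1 / (ε * Real.log 2) + 1) * (n : ℝ) ^ ε) := by
    refine mul_le_mul_of_nonneg_left ?_ (by positivity)
    linarith
  rw [stepBound]
  push_cast
  linarith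

lemma rpow_le_two_pow_stepBound (v : ℕ) (n : ℕ) :
    (n : ℝ) ^ (v + 2) ≤ 2 ^ stepBound v n := by
  have h1 : n ≤ 2 ^ (Nat.log 2 n + 1) := (Nat.lt_pow_succ_log_self (by norm_num) n).le
  have h2 : n ^ (v + 2) ≤ 2 ^ stepBound v n := by
    calc n ^ (v + 2) ≤ (2 ^ (Nat.log 2 n + 1)) ^ (v + 2) := Nat.pow_le_pow_left h1 _
      _ = 2 ^ ((v + 2) * (Nat.log 2 n + 1)) := by rw [← pow_mul, mul_comm]
      _ ≤ _ := Nat.pow_le_pow_right (by norm_num) (Nat.le_succ _)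
  exact_mod_cast h2

variable {X : Type*} [Fintype X] [DecidableEq X] {E : Finset (Finset X)} {ℓ γ : ℕ} {m : ℝ}

/-- Below the threshold, all blocks are of bounded size with high probability. -/
theorem exists_block_size_bound (hE : IsBalancedFamily ℓ m E)
    (hcase : (γ = ℓ - 1 ∧ 3 ≤ #E) ∨ 4 ≤ #E)
    (hγ : ∀ a ∈ E, ∀ b ∈ E, a ≠ b → #(a ∩ b) ≤ γ)
    (hγ' : ∃ b ∈ E, ∃ b' ∈ E, b ≠ b' ∧ γ = #(b ∩ b')) :
    ∃ c : ℝ, 0 < c ∧ ∃ (M : ℕ) (r : ℕ → ℝ), Filter.Tendsto r Filter.atTop (nhds 0) ∧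
      ∀ᶠ n : ℕ in Filter.atTop, ∀ (u : Set (Set (Fin n))) (p : unitInterval),
        (p : ℝ) ≤ c * (n : ℝ) ^ (-(1 / m)) →
        (ProbabilityTheory.setBernoulli u p).real
          {S : Set (Set (Fin n)) | ∃ B : Finset (Finset (Fin n)),
            IsBlockFamily ℓ γ E B ∧ (∀ e ∈ B, (e : Set (Fin n)) ∈ S) ∧ M < #(B.biUnion id)} ≤
          r n := by
  have h3 : 3 ≤ #E := by omega
  have hm := hE.pos
  set v := Fintype.card X with hv
  obtain ⟨α', hα', hgap'⟩ := exists_heavySubgraphs_gap ℓ m E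
  set α := min (α' / m) 1 with hαdef
  have hα : 0 < α := lt_min (by positivity) one_pos
  have hα1 : α ≤ 1 := min_le_right _ _
  have hgap : ∀ J ∈ heavySubgraphs ℓ m E, m * ℓ - 1 + α * m ≤ m * #J.1 - #J.2 := by
    intro J hJ
    have h1 := hgap' J hJ
    have h2 : α * m ≤ α' := by rw [← le_div_iff₀ hm]; exact min_le_left _ _
    linarith
  set A : ℝ := #E * (v : ℝ) ^ ℓ with hA
  have hA0 : 0 ≤ A := by positivity
  set c : ℝ := 1 / (16 * (A + 1)) with hc
  have hc0 : 0 < c := by positivity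
  have hc1 : c ≤ 1 := by
    rw [hc, div_le_one (by positivity)]; linarith
  have hcE : A * c ≤ 1 / 16 := by
    rw [hc, mul_one_div, div_le_div_iff₀ (by positivity) (by norm_num)]
    linarith
  obtain ⟨D, hD⟩ := exists_nat_ge ((v + 2 : ℝ) / (α / 2))
  rw [div_le_iff₀ (by positivity)] at hD
  -- the number of steps is smaller than every power of `n`
  obtain ⟨C1, hC1, hT1⟩ := exists_stepBound_le v (ε := α / 4 / (v + 1)) (by positivity)
  obtain ⟨C2, hC2, hT2⟩ := exists_stepBound_le v (ε := 1) one_pos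
  refine ⟨c, hc0, v * ((2 * v + 3) * D), fun n => (4 + 4 * C2) * (n : ℝ)⁻¹, ?_, ?_⟩
  · simpa using (tendsto_inv_atTop_nhds_zero_nat (𝕜 := ℝ)).const_mul (4 + 4 * C2)
  have hev : ∀ᶠ n : ℕ in Filter.atTop, #(heavySubgraphs ℓ m E) * ((v * C1 : ℝ) ^ v *
      (n : ℝ) ^ (-(α / 4))) ≤ 1 / 16 := by
    have h1 : Filter.Tendsto (fun n : ℕ => #(heavySubgraphs ℓ m E) * ((v * C1 : ℝ) ^ v *
      (n : ℝ) ^ (-(α / 4)))) Filter.atTop (nhds 0) := by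
      have h2 := (tendsto_rpow_neg_atTop (y := α / 4) (by positivity)).comp
        (tendsto_natCast_atTop_atTop (R := ℝ))
      simpa using ((h2.const_mul ((v * C1 : ℝ) ^ v)).const_mul
        (#(heavySubgraphs ℓ m E) : ℝ))
    exact (h1.eventually_lt_const (by norm_num)).mono fun n hn => hn.le
  filter_upwards [hev, Filter.eventually_ge_atTop 1] with n hnb hn u p hp
  have hn0 : (0 : ℝ) < n := by exact_mod_cast hn
  have hn1 : (1 : ℝ) ≤ n := by exact_mod_cast hn
  set T := stepBound v n with hT
  have hTpos : 1 ≤ T := Nat.le_add_left _ _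
  have hbig : #(heavySubgraphs ℓ m E) * ((v * T : ℝ) ^ v * (n : ℝ) ^ (-(α / 2))) ≤ 1 / 16 := by
    refine le_trans (mul_le_mul_of_nonneg_left ?_ (by positivity)) hnb
    have h1 : (v * T : ℝ) ^ v ≤ (v * C1 : ℝ) ^ v * (n : ℝ) ^ (α / 4) := by
      calc (v * T : ℝ) ^ v ≤ ((v * C1) * (n : ℝ) ^ (α / 4 / (v + 1))) ^ v := by
            refine pow_le_pow_left₀ (by positivity) ?_ _
            rw [mul_assoc]
            exact mul_le_mul_of_nonneg_left (hT1 n hn) (by positivity)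
        _ = (v * C1 : ℝ) ^ v * (n : ℝ) ^ (α / 4 / (v + 1) * v) := by
            rw [mul_pow, ← Real.rpow_natCast ((n : ℝ) ^ (α / 4 / (v + 1))) v,
              ← Real.rpow_mul hn0.le]
        _ ≤ (v * C1 : ℝ) ^ v * (n : ℝ) ^ (α / 4) := by
            refine mul_le_mul_of_nonneg_left ?_ (by positivity)
            refine Real.rpow_le_rpow_of_exponent_le hn1 ?_
            rw [div_mul_eq_mul_div, div_le_iff₀ (by positivity)]
            exact mul_le_mul_of_nonneg_left (by linarith) (by positivity)
    calc (v * T : ℝ) ^ v * (n : ℝ) ^ (-(α / 2))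
        ≤ ((v * C1 : ℝ) ^ v * (n : ℝ) ^ (α / 4)) * (n : ℝ) ^ (-(α / 2)) :=
          mul_le_mul_of_nonneg_right h1 (by positivity)
      _ = (v * C1 : ℝ) ^ v * (n : ℝ) ^ (-(α / 4)) := by
          rw [mul_assoc, ← Real.rpow_add hn0]
          congr 2
          ring
  have hq1 : c * (n : ℝ) ^ (-(1 / m)) ≤ 1 := by
    refine mul_le_one₀ hc1 (by positivity) ?_
    exact Real.rpow_le_one_of_one_le_of_nonpos hn1 (by rw [neg_nonpos]; positivity)
  set y : ℝ := (n : ℝ) ^ (α / 2) with hy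
  have hy1 : 1 ≤ y := Real.one_le_rpow hn1 (by positivity)
  have hyn : y ≤ n := by
    calc y ≤ (n : ℝ) ^ (1 : ℝ) := Real.rpow_le_rpow_of_exponent_le hn1 (by linarith)
      _ = n := Real.rpow_one _
  obtain ⟨b, hb, b', hb', hbb, hγeq⟩ := hγ'
  have hprob := prob_large_block_le (V := Fin n) hE hcase hγ
    (fun ψ e he => hγeq ▸ hE.copy_card_inter_lt h3 ψ he hb hb' hbb)
    (by positivity) hq1 hy1 (D := D) hTpos
    (fun l _ hl ψ hψ => sum_copies_threshold_le hE (by omega) hn hc0 hc1 hcE hα hgap hTpos hbig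
      hl hψ) u p hp
  refine hprob.trans ?_
  rw [Fintype.card_fin, ← hv]
  have hW : (n : ℝ) ^ v * y ≤ (n : ℝ) ^ (v + 1) := by
    rw [pow_succ]; exact mul_le_mul_of_nonneg_left hyn (by positivity)
  have e1 : 4 * ((n : ℝ) ^ v * y) * (1 / 2) ^ T ≤ 4 * (n : ℝ)⁻¹ := by
    have h4 := rpow_le_two_pow_stepBound v n
    rw [← hT] at h4
    rw [one_div, inv_pow, ← div_eq_mul_inv, ← div_eq_mul_inv, div_le_div_iff₀ (by positivity) hn0]
    calc 4 * ((n : ℝ) ^ v * y) * n ≤ 4 * (n : ℝ) ^ (v + 1) * n := by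
          gcongr
      _ = 4 * (n : ℝ) ^ (v + 2) := by ring
      _ ≤ 4 * 2 ^ T := by gcongr
  have e2 : T * (4 * ((n : ℝ) ^ v * y) / y ^ (D + 1)) ≤ 4 * C2 * (n : ℝ)⁻¹ := by
    have h5 : (n : ℝ) ^ (v + 2) ≤ y ^ D := by
      rw [hy, ← Real.rpow_natCast, ← Real.rpow_natCast, ← Real.rpow_mul hn0.le]
      refine Real.rpow_le_rpow_of_exponent_le hn1 ?_
      push_cast
      linarith
    have hT2' := hT2 n hn
    rw [Real.rpow_one] at hT2'
    have h6 : 4 * ((n : ℝ) ^ v * y) / y ^ (D + 1) ≤ 4 / (n : ℝ) ^ 2 := by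
      rw [div_le_div_iff₀ (by positivity) (by positivity), pow_succ y]
      calc 4 * ((n : ℝ) ^ v * y) * (n : ℝ) ^ 2 = 4 * ((n : ℝ) ^ (v + 2) * y) := by ring
        _ ≤ 4 * (y ^ D * y) := by gcongr
    calc T * (4 * ((n : ℝ) ^ v * y) / y ^ (D + 1)) ≤ (C2 * n) * (4 / (n : ℝ) ^ 2) :=
          mul_le_mul hT2' h6 (by positivity) (by positivity)
      _ = 4 * C2 * (n : ℝ)⁻¹ := by field_simp
  linarith

end

/-! ### Hypergraphs as finite families of finite sets -/

section

section

variable {V : Type*} [Fintype V]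

open Classical in
/-- The finite sets whose coercions belong to a family `A` of sets. -/
noncomputable def toFam (A : Set (Set V)) : Finset (Finset V) := {a | (a : Set V) ∈ A}

lemma mem_toFam {A : Set (Set V)} {a : Finset V} : a ∈ toFam A ↔ (a : Set V) ∈ A := by
  simp [toFam]

lemma exists_finset_coe (s : Set V) : ∃ a : Finset V, (a : Set V) = s :=
  ⟨s.toFinite.toFinset, s.toFinite.coe_toFinset⟩

lemma card_toFam (A : Set (Set V)) : #(toFam A) = A.ncard := by
  have h : (fun a : Finset V => (a : Set V)) '' (toFam A : Set (Finset V)) = A := by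
    ext s
    constructor
    · rintro ⟨a, ha, rfl⟩; exact mem_toFam.1 ha
    · intro hs
      obtain ⟨a, rfl⟩ := exists_finset_coe s
      exact ⟨a, mem_toFam.2 hs, rfl⟩
  rw [← h, Set.ncard_image_of_injective _ Finset.coe_injective, Set.ncard_coe_finset, h]

end

variable {W : Type*} {F : Hypergraph W}

lemma image_val_coe_injective :
    Function.Injective fun a : Finset F.vertexSet => Subtype.val '' (a : Set F.vertexSet) :=
  fun _ _ h => Finset.coe_injective (Subtype.val_injective.image_injective h)

lemma ncard_image_val (a : Finset F.vertexSet) :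
    (Subtype.val '' (a : Set F.vertexSet)).ncard = #a := by
  rw [Set.ncard_image_of_injective _ Subtype.val_injective, Set.ncard_coe_finset]

lemma ncard_image_val_inter [DecidableEq F.vertexSet] (a b : Finset F.vertexSet) :
    (Subtype.val '' (a : Set F.vertexSet) ∩ Subtype.val '' (b : Set F.vertexSet)).ncard =
      #(a ∩ b) := by
  rw [← Set.image_inter Subtype.val_injective, ← coe_inter, ncard_image_val]

lemma bddAbove_inter_cards (hfin : F.vertexSet.Finite) : BddAbove {k : ℕ | ∃ e₁ ∈ F.edgeSet,
    ∃ e₂ ∈ F.edgeSet, e₁ ≠ e₂ ∧ k = (e₁ ∩ e₂).ncard} := by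
  refine ⟨F.vertexSet.ncard, ?_⟩
  rintro _ ⟨e₁, he₁, e₂, -, -, rfl⟩
  exact Set.ncard_le_ncard (Set.inter_subset_left.trans (F.subset_vertexSet_of_mem_edgeSet' he₁))
    hfin

variable [Fintype F.vertexSet]

open Classical in
/-- The edges of `F` as finite sets of vertices of `F`. -/
noncomputable def edgeFamily (F : Hypergraph W) [Fintype F.vertexSet] :
    Finset (Finset F.vertexSet) :=
  {a | Subtype.val '' (a : Set F.vertexSet) ∈ F.edgeSet}

lemma mem_edgeFamily {a : Finset F.vertexSet} :
    a ∈ edgeFamily F ↔ Subtype.val '' (a : Set F.vertexSet) ∈ F.edgeSet := by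
  simp [edgeFamily]

lemma exists_mem_edgeFamily {e : Set W} (he : e ∈ F.edgeSet) :
    ∃ a ∈ edgeFamily F, Subtype.val '' (a : Set F.vertexSet) = e := by
  obtain ⟨a, ha⟩ := exists_finset_coe (Subtype.val ⁻¹' e : Set F.vertexSet)
  have h : Subtype.val '' (a : Set F.vertexSet) = e := by
    rw [ha, Subtype.image_preimage_coe, Set.inter_eq_right]
    exact F.subset_vertexSet_of_mem_edgeSet' he
  exact ⟨a, mem_edgeFamily.2 (h.symm ▸ he), h⟩

lemma image_edgeFamily :
    (fun a : Finset F.vertexSet => Subtype.val '' (a : Set F.vertexSet)) ''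
      (edgeFamily F : Set (Finset F.vertexSet)) = F.edgeSet := by
  ext s
  constructor
  · rintro ⟨a, ha, rfl⟩; exact mem_edgeFamily.1 ha
  · intro hs
    obtain ⟨a, ha, rfl⟩ := exists_mem_edgeFamily hs
    exact ⟨a, ha, rfl⟩

lemma card_edgeFamily : #(edgeFamily F) = F.numEdges := by
  rw [numEdges, ← image_edgeFamily, Set.ncard_image_of_injective _ image_val_coe_injective,
    Set.ncard_coe_finset]

lemma card_vertexSet_eq : Fintype.card F.vertexSet = F.numVerts := by
  rw [numVerts, ← Nat.card_coe_set_eq, Nat.card_eq_fintype_card]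

lemma isBalancedFamily_edgeFamily {ℓ : ℕ} (hF : F.IsUniformGraph ℓ)
    (hbal : F.IsStrictlyBalanced ℓ) (h2 : 2 ≤ F.numEdges) :
    IsBalancedFamily ℓ (F.maxLDensity ℓ) (edgeFamily F) := by
  obtain ⟨hv, hm, hstrict⟩ := hbal
  have hv' : (0 : ℝ) < (F.numVerts : ℝ) - ℓ := by
    have : (ℓ : ℝ) + 1 ≤ F.numVerts := by exact_mod_cast hv
    linarith
  have he' : (0 : ℝ) < (F.numEdges : ℝ) - 1 := by
    have : (2 : ℝ) ≤ F.numEdges := by exact_mod_cast h2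
    linarith
  refine ⟨fun a ha => ?_, ?_, ?_, fun S Q hQ hQS hS hne => ?_⟩
  · rw [← ncard_image_val, hF.ncard_edge _ (mem_edgeFamily.1 ha)]
  · rw [hm, lDensity]; positivity
  · rw [card_vertexSet_eq, card_edgeFamily, hm, lDensity]
    field_simp
    ring
  · let J : Hypergraph W :=
      { vertexSet := Subtype.val '' (S : Set F.vertexSet)
        edgeSet := (fun a : Finset F.vertexSet => Subtype.val '' (a : Set F.vertexSet)) ''
          (Q : Set (Finset F.vertexSet))
        subset_vertexSet_of_mem_edgeSet' := by
          rintro _ ⟨a, ha, rfl⟩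
          exact Set.image_mono (by exact_mod_cast hQS a ha) }
    have hJV : J.numVerts = #S := ncard_image_val S
    have hJE : J.numEdges = #Q := by
      rw [numEdges, Set.ncard_image_of_injective _ image_val_coe_injective, Set.ncard_coe_finset]
    have hJF : J.IsSubgraph F := by
      constructor
      · rintro _ ⟨x, -, rfl⟩; exact x.2
      · rintro _ ⟨a, ha, rfl⟩; exact mem_edgeFamily.1 (hQ ha)
    have hJne : J ≠ F := by
      intro h
      rcases hne with h1 | h1
      · refine h1 (card_eq_iff_eq_univ S |>.1 ?_)
        rw [← hJV, h, card_vertexSet_eq]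
      · refine h1 (eq_of_subset_of_card_le hQ ?_)
        rw [← hJE, h, card_edgeFamily]
    have h1 := hstrict J hJF hJne (by rw [hJV]; exact hS)
    have hS' : (0 : ℝ) < (#S : ℝ) - ℓ := by
      have : (ℓ : ℝ) + 1 ≤ #S := by exact_mod_cast hS
      linarith
    rw [lDensity, hJV, hJE, div_lt_iff₀ hS'] at h1
    linarith

lemma card_inter_le_maxInter [DecidableEq F.vertexSet] {a b : Finset F.vertexSet}
    (ha : a ∈ edgeFamily F) (hb : b ∈ edgeFamily F) (hab : a ≠ b) : #(a ∩ b) ≤ F.maxInter :=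
  le_csSup (bddAbove_inter_cards (Set.toFinite _)) ⟨_, mem_edgeFamily.1 ha, _, mem_edgeFamily.1 hb,
    fun h => hab (image_val_coe_injective h), (ncard_image_val_inter a b).symm⟩

lemma exists_card_inter_eq_maxInter [DecidableEq F.vertexSet] (h2 : 2 ≤ F.numEdges) :
    ∃ b ∈ edgeFamily F, ∃ b' ∈ edgeFamily F, b ≠ b' ∧ F.maxInter = #(b ∩ b') := by
  have hne : {k : ℕ | ∃ e₁ ∈ F.edgeSet, ∃ e₂ ∈ F.edgeSet, e₁ ≠ e₂ ∧
      k = (e₁ ∩ e₂).ncard}.Nonempty := by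
    obtain ⟨a, ha, b, hb, hab⟩ := one_lt_card.1 (show 1 < #(edgeFamily F) by
      rw [card_edgeFamily]; omega)
    exact ⟨_, _, mem_edgeFamily.1 ha, _, mem_edgeFamily.1 hb,
      fun h => hab (image_val_coe_injective h), rfl⟩
  obtain ⟨e₁, he₁, e₂, he₂, hne, heq⟩ := Nat.sSup_mem hne (bddAbove_inter_cards (Set.toFinite _))
  obtain ⟨a, ha, rfl⟩ := exists_mem_edgeFamily he₁
  obtain ⟨b, hb, rfl⟩ := exists_mem_edgeFamily he₂
  exact ⟨a, ha, b, hb, fun h => hne (by rw [h]), heq.trans (ncard_image_val_inter a b)⟩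

variable {V : Type*} [DecidableEq V]

/-- The hypergraph `F'` is the copy of `F` given by the embedding `φ`. -/
structure IsRealization (F' : Hypergraph V) (φ : F.vertexSet ↪ V) : Prop where
  vertexSet_eq : F'.vertexSet = Set.range φ
  edgeSet_eq : F'.edgeSet = (fun a : Finset V => (a : Set V)) ''
    (copyEdges (edgeFamily F) φ : Set (Finset V))

lemma IsRealization.coe_mem {F' : Hypergraph V} {φ : F.vertexSet ↪ V} (h : IsRealization F' φ)
    {a : Finset V} : (a : Set V) ∈ F'.edgeSet ↔ a ∈ copyEdges (edgeFamily F) φ := by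
  rw [h.edgeSet_eq, Finset.coe_injective.mem_set_image, mem_coe]

lemma IsRealization.subset_toFam [Fintype V] {F' B : Hypergraph V} {φ : F.vertexSet ↪ V}
    (h : IsRealization F' φ) (hB : F'.IsSubgraph B) :
    copyEdges (edgeFamily F) φ ⊆ toFam B.edgeSet := fun _ ha =>
  mem_toFam.2 (hB.2 (h.coe_mem.2 ha))

lemma image_isRealization {f : W → V} {φ : F.vertexSet ↪ V} (hf : ∀ x, φ x = f x.1) :
    IsRealization (F.image f) φ := by
  constructor
  · ext v
    constructor
    · rintro ⟨w, hw, rfl⟩; exact ⟨⟨w, hw⟩, hf _⟩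
    · rintro ⟨x, rfl⟩; exact ⟨x.1, x.2, (hf x).symm⟩
  · have hmap : ∀ a : Finset F.vertexSet,
        ((a.map φ : Finset V) : Set V) = f '' (Subtype.val '' (a : Set F.vertexSet)) := by
      intro a
      rw [coe_map, Set.image_image]
      exact Set.image_congr fun x _ => hf x
    ext s
    constructor
    · rintro ⟨e, he, rfl⟩
      obtain ⟨a, ha, rfl⟩ := exists_mem_edgeFamily he
      exact ⟨a.map φ, mem_copyEdges.2 ⟨a, ha, rfl⟩, hmap a⟩
    · rintro ⟨_, hb, rfl⟩
      obtain ⟨a, ha, rfl⟩ := mem_copyEdges.1 (mem_coe.1 hb)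
      exact ⟨_, mem_edgeFamily.1 ha, (hmap a).symm⟩

lemma IsCopyIn.exists_isRealization {F' B : Hypergraph V} (h : F.IsCopyIn F' B) :
    ∃ φ : F.vertexSet ↪ V, IsRealization F' φ := by
  obtain ⟨-, f, hf, rfl⟩ := h
  exact ⟨⟨fun x => f x.1, fun x y hxy => Subtype.ext (hf x.2 y.2 hxy)⟩,
    image_isRealization fun x => rfl⟩

variable [DecidableEq F.vertexSet] {ℓ : ℕ} {m : ℝ}

lemma IsRealization.range_eq (hE : IsBalancedFamily ℓ m (edgeFamily F))
    (h2 : 2 ≤ #(edgeFamily F)) (φ : F.vertexSet ↪ V) :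
    Set.range φ = (((copyEdges (edgeFamily F) φ).biUnion id : Finset V) : Set V) := by
  rw [hE.biUnion_copyEdges h2]
  simp

lemma IsRealization.unique (hE : IsBalancedFamily ℓ m (edgeFamily F))
    (h2 : 2 ≤ #(edgeFamily F)) {F₁ F₂ : Hypergraph V} {φ₁ φ₂ : F.vertexSet ↪ V}
    (h₁ : IsRealization F₁ φ₁) (h₂ : IsRealization F₂ φ₂)
    (h : copyEdges (edgeFamily F) φ₁ = copyEdges (edgeFamily F) φ₂) : F₁ = F₂ := by
  refine Hypergraph.ext ?_ ?_
  · rw [h₁.vertexSet_eq, h₂.vertexSet_eq, range_eq hE h2, range_eq hE h2, h]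
  · rw [h₁.edgeSet_eq, h₂.edgeSet_eq, h]

variable [Fintype V]

lemma exists_isCopyIn (hE : IsBalancedFamily ℓ m (edgeFamily F)) (h2 : 2 ≤ #(edgeFamily F))
    {φ : F.vertexSet ↪ V} {B : Hypergraph V}
    (h : copyEdges (edgeFamily F) φ ⊆ toFam B.edgeSet) :
    ∃ F' : Hypergraph V, F.IsCopyIn F' B ∧ IsRealization F' φ := by
  classical
  have hcov := hE.biUnion_eq_univ h2
  have hne : Nonempty V := by
    have h0 : Nonempty F.vertexSet := by
      by_contra hempty
      rw [not_nonempty_iff] at hempty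
      have h1 := card_le_one_of_subsingleton (edgeFamily F)
      omega
    exact h0.map φ
  let f : W → V := fun w => if hw : w ∈ F.vertexSet then φ ⟨w, hw⟩ else Classical.arbitrary V
  have hf : ∀ x : F.vertexSet, φ x = f x.1 := fun x => by simp [f]
  have hreal := image_isRealization (F := F) (f := f) hf
  refine ⟨F.image f, ⟨⟨?_, ?_⟩, f, ?_, rfl⟩, hreal⟩
  · rw [hreal.vertexSet_eq]
    rintro _ ⟨x, rfl⟩
    have hx : x ∈ (edgeFamily F).biUnion id := hcov ▸ mem_univ x
    obtain ⟨a, ha, hxa⟩ := mem_biUnion.1 hx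
    have h1 := mem_toFam.1 (h (mem_copyEdges.2 ⟨a, ha, rfl⟩))
    exact B.subset_vertexSet_of_mem_edgeSet' h1 (mem_coe.2 (mem_map_of_mem φ hxa))
  · rw [hreal.edgeSet_eq]
    rintro _ ⟨a, ha, rfl⟩
    exact mem_toFam.1 (h ha)
  · intro x hx y hy hxy
    have := φ.injective (((hf ⟨x, hx⟩).trans hxy).trans (hf ⟨y, hy⟩).symm)
    exact congrArg Subtype.val this

lemma IsClosedGraph.vertexSet_eq (hE : IsBalancedFamily ℓ m (edgeFamily F))
    (h2 : 2 ≤ #(edgeFamily F)) {B : Hypergraph V} (hB : IsClosedGraph ℓ F B) :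
    B.vertexSet = (((toFam B.edgeSet).biUnion id : Finset V) : Set V) := by
  ext x
  constructor
  · intro hx
    obtain ⟨F', hF', hxF'⟩ := hB.vertex_mem_copy x hx
    obtain ⟨φ, hφ⟩ := hF'.exists_isRealization
    rw [hφ.vertexSet_eq, IsRealization.range_eq hE h2] at hxF'
    exact biUnion_subset_biUnion_of_subset_left id (hφ.subset_toFam hF'.1) hxF'
  · intro hx
    obtain ⟨a, ha, hxa⟩ := mem_biUnion.1 (mem_coe.1 hx)
    exact B.subset_vertexSet_of_mem_edgeSet' (mem_toFam.1 ha) (mem_coe.2 hxa)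

/-- The edge set of an `F`-block is a block in the sense of finite families. -/
lemma IsBlock.isBlockFamily (hE : IsBalancedFamily ℓ m (edgeFamily F))
    (h2 : 2 ≤ #(edgeFamily F)) {B : Hypergraph V} (hB : IsBlock ℓ F B) :
    IsBlockFamily ℓ F.maxInter (edgeFamily F) (toFam B.edgeSet) := by
  have hclosed : ∀ (φ : F.vertexSet ↪ V) (a : Finset V), IsClosedEdge ℓ F B a →
      (F.maxInter = ℓ - 1 → ∃ ψ : F.vertexSet ↪ V,
        copyEdges (edgeFamily F) ψ ⊆ toFam B.edgeSet ∧ a ∈ copyEdges (edgeFamily F) ψ ∧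
        copyEdges (edgeFamily F) ψ ≠ copyEdges (edgeFamily F) φ) ∧
      (F.maxInter ≠ ℓ - 1 → ∀ g' ∈ toFam B.edgeSet, g' ≠ a → ∃ ψ : F.vertexSet ↪ V,
        copyEdges (edgeFamily F) ψ ⊆ toFam B.edgeSet ∧
        ¬ (a ∈ copyEdges (edgeFamily F) ψ ↔ g' ∈ copyEdges (edgeFamily F) ψ)) := by
    rintro φ a ⟨-, h⟩
    constructor
    · intro hγ
      have htwo : F.InTwoCopies B (a : Set V) := h.elim (fun h => h.2) (fun h => h.2.1)
      obtain ⟨F₁, F₂, hne, hF₁, hF₂, ha₁, ha₂⟩ := htwo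
      obtain ⟨φ₁, hφ₁⟩ := hF₁.exists_isRealization
      obtain ⟨φ₂, hφ₂⟩ := hF₂.exists_isRealization
      by_cases heq : copyEdges (edgeFamily F) φ₁ = copyEdges (edgeFamily F) φ
      · refine ⟨φ₂, hφ₂.subset_toFam hF₂.1, hφ₂.coe_mem.1 ha₂, fun h => hne ?_⟩
        exact hφ₁.unique hE h2 hφ₂ (heq.trans h.symm)
      · exact ⟨φ₁, hφ₁.subset_toFam hF₁.1, hφ₁.coe_mem.1 ha₁, heq⟩
    · intro hγ g' hg' hne
      have hsep := (h.resolve_left fun h => hγ h.1).2.2 g' (mem_toFam.1 hg')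
        (fun h => hne (Finset.coe_injective h))
      rw [EdgeEquiv] at hsep
      push Not at hsep
      obtain ⟨F', hF', hiff⟩ := hsep
      obtain ⟨ψ, hψ⟩ := hF'.exists_isRealization
      refine ⟨ψ, hψ.subset_toFam hF'.1, ?_⟩
      rw [← hψ.coe_mem, ← hψ.coe_mem]
      tauto
  refine ⟨fun φ hφ => ?_, fun E' hne hss => ?_, fun e he => ?_⟩
  · obtain ⟨F', hF', hreal⟩ := exists_isCopyIn hE h2 hφ
    obtain ⟨e₁, he₁, e₂, he₂, e₃, he₃, h12, h13, h23, hc₁, hc₂, hc₃⟩ :=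
      hB.isClosedGraph.closed_copy F' hF'
    obtain ⟨a₁, rfl⟩ := exists_finset_coe e₁
    obtain ⟨a₂, rfl⟩ := exists_finset_coe e₂
    obtain ⟨a₃, rfl⟩ := exists_finset_coe e₃
    refine ⟨{a₁, a₂, a₃}, ?_, ?_, ?_⟩
    · simp only [insert_subset_iff, singleton_subset_iff]
      exact ⟨hreal.coe_mem.1 he₁, hreal.coe_mem.1 he₂, hreal.coe_mem.1 he₃⟩
    · rw [card_eq_three.2 ⟨a₁, a₂, a₃, fun h => h12 (by rw [h]), fun h => h13 (by rw [h]),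
        fun h => h23 (by rw [h]), rfl⟩]
    · intro g hg
      simp only [mem_insert, mem_singleton] at hg
      rcases hg with rfl | rfl | rfl
      exacts [hclosed φ _ hc₁, hclosed φ _ hc₂, hclosed φ _ hc₃]
  · have hss' : (fun a : Finset V => (a : Set V)) '' (E' : Set (Finset V)) ⊂ B.edgeSet := by
      refine ⟨?_, fun h => hss.2 fun a ha => ?_⟩
      · rintro _ ⟨a, ha, rfl⟩
        exact mem_toFam.1 (hss.1 ha)
      · have := h (mem_toFam.1 ha)
        rwa [Finset.coe_injective.mem_set_image] at this
    obtain ⟨F', hF', ⟨s, hs, hsE⟩, ⟨t, ht, htE⟩⟩ := hB.exists_copy _ (by simpa using hne) hss'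
    obtain ⟨ψ, hψ⟩ := hF'.exists_isRealization
    obtain ⟨a, ha, rfl⟩ := hsE
    obtain ⟨b, rfl⟩ := exists_finset_coe t
    refine ⟨ψ, hψ.subset_toFam hF'.1, ⟨a, mem_inter.2 ⟨hψ.coe_mem.1 hs, ha⟩⟩, fun hsub => htE ?_⟩
    exact ⟨b, hsub (hψ.coe_mem.1 ht), rfl⟩
  · obtain ⟨F', hF', heF'⟩ := hB.isClosedGraph.edge_mem_copy e (mem_toFam.1 he)
    obtain ⟨ψ, hψ⟩ := hF'.exists_isRealization
    exact ⟨ψ, hψ.subset_toFam hF'.1, hψ.coe_mem.1 heF'⟩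

end

/-! ### Small dense subgraphs -/

section

/-- A first moment bound for sets of `k` vertices spanning at least `e` edges. -/
lemma prob_subgraph_le {V : Type*} [Fintype V] (u : Set (Set V)) (p : unitInterval) (k e : ℕ) :
    (ProbabilityTheory.setBernoulli u p).real {S : Set (Set V) | ∃ (Y : Finset V)
      (D : Finset (Finset V)), #Y = k ∧ #D = e ∧ (∀ a ∈ D, a ⊆ Y) ∧ ∀ a ∈ D, (a : Set V) ∈ S} ≤
    (2 : ℝ) ^ 2 ^ k * ((Fintype.card V : ℝ) ^ k * (p : ℝ) ^ e) := by
  have hp0 : 0 ≤ (p : ℝ) := p.2.1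
  set I : Finset ((_ : Finset V) × Finset (Finset V)) :=
    (powersetCard k univ).sigma fun Y => powersetCard e Y.powerset with hI
  calc _ ≤ (ProbabilityTheory.setBernoulli u p).real
        {S : Set (Set V) | ∃ x ∈ I, ∀ a ∈ x.2, (a : Set V) ∈ S} := by
        refine MeasureTheory.measureReal_mono ?_ (MeasureTheory.measure_ne_top _ _)
        rintro S ⟨Y, D, hY, hD, hDY, hDS⟩
        refine ⟨⟨Y, D⟩, mem_sigma.2 ⟨mem_powersetCard.2 ⟨subset_univ _, hY⟩,
          mem_powersetCard.2 ⟨fun a ha => mem_powerset.2 (hDY a ha), hD⟩⟩, hDS⟩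
    _ ≤ ∑ x ∈ I, (p : ℝ) ^ #x.2 := setBernoulli_real_exists_finset_le u p I _
    _ = ∑ Y ∈ powersetCard k (univ : Finset V), ∑ D ∈ powersetCard e Y.powerset,
          (p : ℝ) ^ #D := sum_sigma _ _ _
    _ ≤ ∑ Y ∈ powersetCard k (univ : Finset V), (2 : ℝ) ^ 2 ^ k * (p : ℝ) ^ e := by
        refine sum_le_sum fun Y hY => ?_
        have hYk : #Y = k := (mem_powersetCard.1 hY).2
        rw [sum_congr rfl fun D hD => by rw [(mem_powersetCard.1 hD).2], sum_const,
          card_powersetCard, card_powerset, hYk, nsmul_eq_mul]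
        refine mul_le_mul_of_nonneg_right ?_ (by positivity)
        exact_mod_cast Nat.choose_le_two_pow (2 ^ k) e
    _ ≤ _ := by
        rw [sum_const, card_powersetCard, card_univ, nsmul_eq_mul]
        have h1 : ((Fintype.card V).choose k : ℝ) ≤ (Fintype.card V : ℝ) ^ k := by
          exact_mod_cast Nat.choose_le_pow _ _
        calc _ ≤ (Fintype.card V : ℝ) ^ k * ((2 : ℝ) ^ 2 ^ k * (p : ℝ) ^ e) :=
              mul_le_mul_of_nonneg_right h1 (by positivity)
          _ = _ := by ring

/-- If subgraphs with numbers of vertices and edges related by `P` are not expected to occur, then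
with high probability none of them on a bounded number of vertices occurs. -/
lemma tendsto_prob_subgraph (u : ∀ n : ℕ, Set (Set (Fin n))) (p : ℕ → unitInterval) (M : ℕ)
    (P : ℕ → ℕ → Prop)
    (hP : ∀ k e, 1 ≤ k → P k e →
      Filter.Tendsto (fun n : ℕ => (n : ℝ) ^ k * (p n : ℝ) ^ e) Filter.atTop (nhds 0)) :
    Filter.Tendsto (fun n : ℕ => (ProbabilityTheory.setBernoulli (u n) (p n)).real
      {S : Set (Set (Fin n)) | ∃ (Y : Finset (Fin n)) (D : Finset (Finset (Fin n))),
        1 ≤ #Y ∧ #Y ≤ M ∧ P #Y #D ∧ (∀ a ∈ D, a ⊆ Y) ∧ ∀ a ∈ D, (a : Set (Fin n)) ∈ S})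
      Filter.atTop (nhds 0) := by
  classical
  set I : Finset (ℕ × ℕ) := {x ∈ Icc 1 M ×ˢ range (2 ^ M + 1) | P x.1 x.2} with hI
  have hlim : Filter.Tendsto (fun n : ℕ => ∑ x ∈ I, (2 : ℝ) ^ 2 ^ x.1 *
      ((n : ℝ) ^ x.1 * (p n : ℝ) ^ x.2)) Filter.atTop (nhds 0) := by
    have h0 : ∀ x ∈ I, Filter.Tendsto (fun n : ℕ => (2 : ℝ) ^ 2 ^ x.1 *
        ((n : ℝ) ^ x.1 * (p n : ℝ) ^ x.2)) Filter.atTop (nhds 0) := by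
      intro x hx
      obtain ⟨hx1, hx2⟩ := mem_filter.1 hx
      have := (hP x.1 x.2 (mem_Icc.1 (mem_product.1 hx1).1).1 hx2).const_mul ((2 : ℝ) ^ 2 ^ x.1)
      simpa using this
    simpa using tendsto_finsetSum I h0
  refine squeeze_zero (fun n => MeasureTheory.measureReal_nonneg) (fun n => ?_) hlim
  calc _ ≤ (ProbabilityTheory.setBernoulli (u n) (p n)).real (⋃ x ∈ I,
        {S : Set (Set (Fin n)) | ∃ (Y : Finset (Fin n)) (D : Finset (Finset (Fin n))),
          #Y = x.1 ∧ #D = x.2 ∧ (∀ a ∈ D, a ⊆ Y) ∧ ∀ a ∈ D, (a : Set (Fin n)) ∈ S}) := by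
        refine MeasureTheory.measureReal_mono ?_ (MeasureTheory.measure_ne_top _ _)
        rintro S ⟨Y, D, hY1, hYM, hYD, hDY, hDS⟩
        refine Set.mem_iUnion₂.2 ⟨(#Y, #D), mem_filter.2 ⟨mem_product.2 ⟨mem_Icc.2 ⟨hY1, hYM⟩,
          mem_range.2 (Nat.lt_succ_of_le ?_)⟩, hYD⟩, Y, D, rfl, rfl, hDY, hDS⟩
        calc #D ≤ #Y.powerset := card_le_card fun a ha => mem_powerset.2 (hDY a ha)
          _ = 2 ^ #Y := card_powerset Y
          _ ≤ 2 ^ M := Nat.pow_le_pow_right (by norm_num) hYM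
    _ ≤ ∑ x ∈ I, (ProbabilityTheory.setBernoulli (u n) (p n)).real
        {S : Set (Set (Fin n)) | ∃ (Y : Finset (Fin n)) (D : Finset (Finset (Fin n))),
          #Y = x.1 ∧ #D = x.2 ∧ (∀ a ∈ D, a ⊆ Y) ∧ ∀ a ∈ D, (a : Set (Fin n)) ∈ S} :=
        MeasureTheory.measureReal_biUnion_finset_le _ _
    _ ≤ _ := by
        refine sum_le_sum fun x _ => ?_
        have := prob_subgraph_le (u n) (p n) x.1 x.2
        rwa [Fintype.card_fin] at this

lemma tendsto_pow_mul_pow_of_le {m c : ℝ} (hm : 0 < m) {p : ℕ → unitInterval}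
    (hp : ∀ᶠ n : ℕ in Filter.atTop, (p n : ℝ) ≤ c * (n : ℝ) ^ (-(1 / m))) {k e : ℕ}
    (hke : m * k < e) :
    Filter.Tendsto (fun n : ℕ => (n : ℝ) ^ k * (p n : ℝ) ^ e) Filter.atTop (nhds 0) := by
  have hexp : 0 < e / m - k := by
    rw [sub_pos, lt_div_iff₀ hm]; linarith
  have hlim : Filter.Tendsto (fun n : ℕ => c ^ e * (n : ℝ) ^ (-(e / m - k) : ℝ)) Filter.atTop
      (nhds 0) := by
    simpa using ((tendsto_rpow_neg_atTop hexp).comp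
      (tendsto_natCast_atTop_atTop (R := ℝ))).const_mul (c ^ e)
  refine squeeze_zero' (Filter.Eventually.of_forall fun n => ?_) ?_ hlim
  · have : 0 ≤ (p n : ℝ) := (p n).2.1
    positivity
  · filter_upwards [hp, Filter.eventually_ge_atTop 1] with n hpn hn
    have hp0 : 0 ≤ (p n : ℝ) := (p n).2.1
    calc (n : ℝ) ^ k * (p n : ℝ) ^ e ≤ (n : ℝ) ^ k * (c * (n : ℝ) ^ (-(1 / m))) ^ e := by gcongr
      _ = _ := by rw [pow_mul_threshold_pow hn, neg_sub]

lemma tendsto_pow_mul_pow_of_isLittleO {m : ℝ} (hm : 0 < m) {p : ℕ → unitInterval}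
    (hp : Asymptotics.IsLittleO Filter.atTop (fun n : ℕ => (p n : ℝ))
      (fun n : ℕ => (n : ℝ) ^ (-(1 / m)))) {k e : ℕ} (hk : 1 ≤ k) (hke : m * k ≤ e) :
    Filter.Tendsto (fun n : ℕ => (n : ℝ) ^ k * (p n : ℝ) ^ e) Filter.atTop (nhds 0) := by
  have he : e ≠ 0 := by
    rintro rfl
    have : (1 : ℝ) ≤ k := by exact_mod_cast hk
    have : 0 < m * k := by positivity
    simp at hke
    linarith
  have hlim : Filter.Tendsto (fun n : ℕ => ((p n : ℝ) / (n : ℝ) ^ (-(1 / m))) ^ e) Filter.atTop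
      (nhds 0) := by
    simpa [he] using hp.tendsto_div_nhds_zero.pow e
  refine squeeze_zero' (Filter.Eventually.of_forall fun n => ?_) ?_ hlim
  · have : 0 ≤ (p n : ℝ) := (p n).2.1
    positivity
  · filter_upwards [Filter.eventually_ge_atTop 1] with n hn
    have hp0 : 0 ≤ (p n : ℝ) := (p n).2.1
    have hn0 : (0 : ℝ) < n := by exact_mod_cast hn
    have hn1 : (1 : ℝ) ≤ n := by exact_mod_cast hn
    have hx : 0 < (n : ℝ) ^ (-(1 / m)) := by positivity
    have h1 := pow_mul_threshold_pow hn ((p n : ℝ) / (n : ℝ) ^ (-(1 / m))) m k e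
    rw [div_mul_cancel₀ _ hx.ne'] at h1
    rw [h1]
    refine mul_le_of_le_one_right (by positivity) ?_
    refine Real.rpow_le_one_of_one_le_of_nonpos hn1 ?_
    rw [sub_nonpos, le_div_iff₀ hm]
    linarith

/-- The maximum in the definition of `m(B)` is attained. -/
lemma exists_density_eq_maxDensity {V : Type*} [Fintype V] {B : Hypergraph V}
    (hB : B.vertexSet.Nonempty) :
    ∃ J : Hypergraph V, J.IsSubgraph B ∧ 1 ≤ J.numVerts ∧ B.maxDensity = J.density := by
  have hne : {x : ℝ | ∃ J : Hypergraph V, J.IsSubgraph B ∧ 1 ≤ J.numVerts ∧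
      x = J.density}.Nonempty := by
    refine ⟨_, B, ⟨subset_rfl, subset_rfl⟩, ?_, rfl⟩
    exact (Set.ncard_pos (Set.toFinite _)).2 hB
  refine hne.csSup_mem ?_
  refine ((Set.finite_Iic (Nat.card (Set V))).prod (Set.finite_Iic (Nat.card V))).image
    (fun x : ℕ × ℕ => (x.1 : ℝ) / (x.2 : ℝ)) |>.subset ?_
  rintro _ ⟨J, -, -, rfl⟩
  exact ⟨(J.numEdges, J.numVerts), ⟨Set.ncard_le_card _, Set.ncard_le_card _⟩, rfl⟩

/-- A property of the random `ℓ`-graph holds with high probability if its failure is contained in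
the union of two events of vanishing probability. -/
lemma tendsto_randomProb_one {ℓ : ℕ} {p : ℕ → unitInterval}
    {Q : ∀ n : ℕ, Hypergraph (Fin n) → Prop} {A A' : ∀ n : ℕ, Set (Set (Set (Fin n)))}
    (h : ∀ n S, S ∉ A n → S ∉ A' n → Q n (ofEdgeSet S))
    (hA : Filter.Tendsto (fun n : ℕ => (ProbabilityTheory.setBernoulli
      {e : Set (Fin n) | e.ncard = ℓ} (p n)).real (A n)) Filter.atTop (nhds 0))
    (hA' : Filter.Tendsto (fun n : ℕ => (ProbabilityTheory.setBernoulli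
      {e : Set (Fin n) | e.ncard = ℓ} (p n)).real (A' n)) Filter.atTop (nhds 0)) :
    Filter.Tendsto (fun n : ℕ => randomProb ℓ n (p n) (Q n)) Filter.atTop (nhds 1) := by
  have hlim := (hA.add hA').const_sub 1
  simp only [add_zero, sub_zero] at hlim
  refine tendsto_of_tendsto_of_tendsto_of_le_of_le hlim tendsto_const_nhds (fun n => ?_)
    (fun n => MeasureTheory.measureReal_le_one)
  have huniv : (Set.univ : Set (Set (Set (Fin n)))) ⊆
      (A n ∪ A' n) ∪ {S | Q n (ofEdgeSet S)} := by
    intro S _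
    by_cases h1 : S ∈ A n
    · exact Or.inl (Or.inl h1)
    · by_cases h2 : S ∈ A' n
      · exact Or.inl (Or.inr h2)
      · exact Or.inr (h n S h1 h2)
  set μ := ProbabilityTheory.setBernoulli {e : Set (Fin n) | e.ncard = ℓ} (p n) with hμ
  have h1 : (1 : ℝ) ≤ (μ.real (A n) + μ.real (A' n)) + μ.real {S | Q n (ofEdgeSet S)} := by
    calc (1 : ℝ) = μ.real Set.univ := by simp
      _ ≤ μ.real ((A n ∪ A' n) ∪ {S | Q n (ofEdgeSet S)}) :=
          MeasureTheory.measureReal_mono huniv (MeasureTheory.measure_ne_top _ _)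
      _ ≤ μ.real (A n ∪ A' n) + μ.real {S | Q n (ofEdgeSet S)} :=
          MeasureTheory.measureReal_union_le _ _
      _ ≤ _ := by
          gcongr
          exact MeasureTheory.measureReal_union_le _ _
  rw [randomProb]
  linarith

/-- In a block with at most `M` vertices, a subgraph of maximal density is a small dense
subgraph. -/
lemma IsBlock.exists_subgraph {V W : Type*} [Fintype V] [DecidableEq V] {F : Hypergraph W}
    [Fintype F.vertexSet] [DecidableEq F.vertexSet] {ℓ M : ℕ} {m : ℝ} {S : Set (Set V)}
    (hE : IsBalancedFamily ℓ m (edgeFamily F)) (h2 : 2 ≤ #(edgeFamily F)) {B : Hypergraph V}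
    (hB : IsBlock ℓ F B) (hBS : B.IsSubgraph (ofEdgeSet S))
    (hM : #((toFam B.edgeSet).biUnion id) ≤ M) (hpos : B.maxDensity ≠ 0) :
    ∃ (Y : Finset V) (D : Finset (Finset V)), 1 ≤ #Y ∧ #Y ≤ M ∧
      B.maxDensity * #Y = #D ∧ (∀ a ∈ D, a ⊆ Y) ∧ ∀ a ∈ D, (a : Set V) ∈ S := by
  have hne : B.vertexSet.Nonempty := by
    by_contra hempty
    rw [Set.not_nonempty_iff_eq_empty] at hempty
    refine hpos ?_
    rw [maxDensity]
    convert Real.sSup_empty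
    refine Set.eq_empty_iff_forall_notMem.2 ?_
    rintro x ⟨J, hJ, hJ1, -⟩
    have h1 : J.vertexSet = ∅ := Set.subset_empty_iff.1 (hempty ▸ hJ.1)
    rw [numVerts, h1, Set.ncard_empty] at hJ1
    omega
  obtain ⟨J, hJ, hJ1, hJd⟩ := exists_density_eq_maxDensity hne
  obtain ⟨Y, hY⟩ := exists_finset_coe J.vertexSet
  have hYc : #Y = J.numVerts := by rw [numVerts, ← hY, Set.ncard_coe_finset]
  refine ⟨Y, toFam J.edgeSet, by omega, ?_, ?_, fun a ha => ?_, fun a ha => ?_⟩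
  · refine le_trans (card_le_card ?_) hM
    rw [← coe_subset, hY, ← hB.isClosedGraph.vertexSet_eq hE h2]
    exact hJ.1
  · rw [hYc, card_toFam, hJd, density, numEdges]
    have : (J.numVerts : ℝ) ≠ 0 := by
      have : (1 : ℝ) ≤ J.numVerts := by exact_mod_cast hJ1
      linarith
    field_simp
  · rw [← coe_subset, hY]
    exact J.subset_vertexSet_of_mem_edgeSet' (mem_toFam.1 ha)
  · exact hBS.2 (hJ.2 (mem_toFam.1 ha))

end

end Hypergraph


theorem corollary2p6 {W : Type*} (ℓ : ℕ) (hℓ : 2 ≤ ℓ) (F : Hypergraph W)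
    (hF : Hypergraph.IsUniformGraph ℓ F) (hbal : Hypergraph.IsStrictlyBalanced ℓ F)
    (hcase : (F.maxInter = ℓ - 1 ∧ 3 ≤ F.numEdges) ∨ 4 ≤ F.numEdges) :
    (∃ c : ℝ, 0 < c ∧ ∀ p : ℕ → unitInterval,
      (∀ᶠ n : ℕ in Filter.atTop, (p n : ℝ) ≤ c * (n : ℝ) ^ (-(1 / F.maxLDensity ℓ))) →
      Filter.Tendsto
        (fun n : ℕ => Hypergraph.randomProb ℓ n (p n) (fun G =>
          ∀ B : Hypergraph (Fin n), B.IsSubgraph G → Hypergraph.IsBlock ℓ F B →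
            B.maxDensity ≤ F.maxLDensity ℓ))
        Filter.atTop (nhds 1)) ∧
    (∀ p : ℕ → unitInterval,
      Asymptotics.IsLittleO Filter.atTop (fun n : ℕ => (p n : ℝ))
        (fun n : ℕ => (n : ℝ) ^ (-(1 / F.maxLDensity ℓ))) →
      Filter.Tendsto
        (fun n : ℕ => Hypergraph.randomProb ℓ n (p n) (fun G =>
          ∀ B : Hypergraph (Fin n), B.IsSubgraph G → Hypergraph.IsBlock ℓ F B →
            B.maxDensity < F.maxLDensity ℓ))
        Filter.atTop (nhds 1)) := by
  classical
  let _ : Fintype F.vertexSet := hF.finite_vertexSet.fintype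
  have h2 : 2 ≤ F.numEdges := by omega
  have hE := Hypergraph.isBalancedFamily_edgeFamily hF hbal h2
  have hm := hE.pos
  have h2' : 2 ≤ Finset.card (Hypergraph.edgeFamily F) := by
    rwa [Hypergraph.card_edgeFamily]
  obtain ⟨c, hc, M, r, hr, hbound⟩ := Hypergraph.exists_block_size_bound hE
    (by rwa [Hypergraph.card_edgeFamily])
    (fun a ha b hb hab => Hypergraph.card_inter_le_maxInter ha hb hab)
    (Hypergraph.exists_card_inter_eq_maxInter h2)
  set m := F.maxLDensity ℓ
  -- with high probability, all blocks have at most `M` vertices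
  have hsize : ∀ p : ℕ → unitInterval,
      (∀ᶠ n : ℕ in Filter.atTop, (p n : ℝ) ≤ c * (n : ℝ) ^ (-(1 / m))) →
      Filter.Tendsto (fun n : ℕ => (ProbabilityTheory.setBernoulli
        {e : Set (Fin n) | e.ncard = ℓ} (p n)).real {S : Set (Set (Fin n)) |
          ∃ B : Finset (Finset (Fin n)),
            Hypergraph.IsBlockFamily ℓ F.maxInter (Hypergraph.edgeFamily F) B ∧
            (∀ e ∈ B, (e : Set (Fin n)) ∈ S) ∧ M < (B.biUnion id).card})
        Filter.atTop (nhds 0) := by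
    intro p hp
    refine squeeze_zero' (Filter.Eventually.of_forall fun n => MeasureTheory.measureReal_nonneg)
      ?_ hr
    filter_upwards [hbound, hp] with n hn hpn
    exact hn _ _ hpn
  have hblock : ∀ (n : ℕ) (S : Set (Set (Fin n))), S ∉ {S : Set (Set (Fin n)) |
      ∃ B : Finset (Finset (Fin n)),
        Hypergraph.IsBlockFamily ℓ F.maxInter (Hypergraph.edgeFamily F) B ∧
        (∀ e ∈ B, (e : Set (Fin n)) ∈ S) ∧ M < (B.biUnion id).card} →
      ∀ B : Hypergraph (Fin n), B.IsSubgraph (Hypergraph.ofEdgeSet S) →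
        Hypergraph.IsBlock ℓ F B → ((Hypergraph.toFam B.edgeSet).biUnion id).card ≤ M := by
    intro n S hS B hBS hB
    by_contra! hlt
    exact hS ⟨Hypergraph.toFam B.edgeSet, hB.isBlockFamily hE h2',
      fun e he => hBS.2 (Hypergraph.mem_toFam.1 he), hlt⟩
  refine ⟨⟨c, hc, fun p hp => ?_⟩, fun p hp => ?_⟩
  · refine Hypergraph.tendsto_randomProb_one (fun n S h1 h3 B hBS hB => ?_) (hsize p hp)
      (Hypergraph.tendsto_prob_subgraph _ p M (fun k e => m * k < e)
        fun k e _ hke => Hypergraph.tendsto_pow_mul_pow_of_le hm hp hke)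
    by_contra! hlt
    obtain ⟨Y, D, hY1, hYM, hD, hDY, hDS⟩ :=
      hB.exists_subgraph hE h2' hBS (hblock n S h1 B hBS hB) (hm.trans hlt).ne'
    refine h3 ⟨Y, D, hY1, hYM, ?_, hDY, hDS⟩
    rw [← hD]
    exact mul_lt_mul_of_pos_right hlt (by exact_mod_cast hY1)
  · have hp' : ∀ᶠ n : ℕ in Filter.atTop, (p n : ℝ) ≤ c * (n : ℝ) ^ (-(1 / m)) := by
      filter_upwards [hp.bound hc] with n hn
      rwa [Real.norm_of_nonneg (p n).2.1, Real.norm_of_nonneg (by positivity)] at hn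
    refine Hypergraph.tendsto_randomProb_one (fun n S h1 h3 B hBS hB => ?_) (hsize p hp')
      (Hypergraph.tendsto_prob_subgraph _ p M (fun k e => m * k ≤ e)
        fun k e hk hke => Hypergraph.tendsto_pow_mul_pow_of_isLittleO hm hp hk hke)
    by_contra! hle
    obtain ⟨Y, D, hY1, hYM, hD, hDY, hDS⟩ :=
      hB.exists_subgraph hE h2' hBS (hblock n S h1 B hBS hB) (hm.trans_le hle).ne'
    refine h3 ⟨Y, D, hY1, hYM, ?_, hDY, hDS⟩
    rw [← hD]
    exact mul_le_mul_of_nonneg_right hle (by positivity)
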